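/- Let $p,q,n\ge 1$ be integers with $p+q$ odd, and let $a,b\in\{1,-1\}$, with $p\ne 1$ if $b=1$ and $q\ne 1$ if $a=1$. Put $\mathcal H_k^{(p)}(b)=\sum_{m=1}^{k}\frac{b^{m-1}}{m^p}$. For $c=\pm1$, $\alpha>0$ and an integer $s\ge 1$ (with $s\neq 1$ if $c=1$) let $\Phi(c,s,\alpha)=\sum_{m=0}^\infty \frac{c^m}{(m+\alpha)^s}$ be the Lerch transcendent, and for order $0$ use the analytically continued values $\Phi(1,0,1)=\zeta(0)=-\tfrac12$ and $\Phi(-1,0,1)=\eta(0)=\tfrac12$, where $\eta(s)=(1-2^{1-s})\zeta(s)$. For $0<s<r$ and an integer $k\ge1$ let \[\Theta(c,k,s,r)=\Phi\left(c,k,\tfrac sr\right)+c(-1)^k\,\Phi\left(c,k,\tfrac{r-s}{r}\right)\quad\text{if }(c,k)\ne(1,1),\qquad \Theta(1,1,s,r)=\pi\cot\left(\tfrac{\pi s}{r}\right).\] Then the following series converges (possibly conditionally, the partial sums being taken over $k\le N$, $N\to\infty$), and \[\sum_{k=1}^\infty (a^n)^k\,\mathcal H_k^{(p)}(b)\sum_{j=1}^n\frac{a^{j-1}}{(nk+j)^q}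 =-\frac12 a^{n-1}n^{-q}\,\Phi(a^nb,p+q,1)+\frac12\left(1+(-1)^q\right)\Phi(a,q,1)\,\Phi(b,p,1)\] \[-a^{n-1}b(-n)^{-q}\sum_{j=0}^{\lfloor q/2\rfloor}\binom{p+q-2j-1}{p-1}\Phi(a^nb,2j,1)\,\Phi(b,p+q-2j,1)\] \[+a^n(-n)^p\sum_{k=0}^{\lfloor p/2\rfloor}\binom{p+q-2k-1}{q-1}n^{-2k}\,\Phi(a^nb,2k,1)\,\Phi(a,p+q-2k,1)\] \[-\frac12(-n)^{-q}\sum_{j=2}^n\sum_{k=1}^q\binom{p+q-k-1}{p-1}a^j(-1)^k\,\Theta(a^nb,k,j-1,n)\,\Phi\left(b,p+q-k,\tfrac{n-j+1}{n}\right).\] -/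

import Mathlib

open Filter Topology Finset

noncomputable section

/-- The Lerch transcendent `Φ(c, q, α)` of natural order `q`, for real `c` and `α`
(used for `c = ±1` and `α > 0`). For `q ≥ 1` it is the sum of the series
`∑_{n ≥ 0} c ^ n / (n + α) ^ q`, as the limit of the partial sums, since the series converges only
conditionally for `c = -1`, `q = 1`. For `q = 0` the series diverges and the value is the one of the
analytic continuation in the order: `ζ(0, α) = 1 / 2 - α` for `c = 1` (so `Φ(1, 0, 1) = -1 / 2`),
and `1 / (1 - c)` otherwise (so `Φ(-1, 0, 1) = η(0) = 1 / 2`). -/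
def lerchPhi (c : ℝ) (q : ℕ) (α : ℝ) : ℝ :=
  if q = 0 then (if c = 1 then 1 / 2 - α else 1 / (1 - c))
  else limUnder atTop (fun N : ℕ => ∑ n ∈ range N, c ^ n / ((n : ℝ) + α) ^ q)

theorem lerchPhi_eq_of_tendsto {c : ℝ} {q : ℕ} {α l : ℝ} (hq : q ≠ 0)
    (h : Tendsto (fun N : ℕ => ∑ n ∈ range N, c ^ n / ((n : ℝ) + α) ^ q) atTop (𝓝 l)) :
    lerchPhi c q α = l := by
  rw [lerchPhi, if_neg hq]
  exact h.limUnder_eq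

/-- `Φ(1, 0, 1) = ζ(0)`. -/
theorem lerchPhi_one_zero_one : ((lerchPhi 1 0 1 : ℝ) : ℂ) = riemannZeta 0 := by
  rw [riemannZeta_zero, lerchPhi]
  norm_num

/-- `Φ(-1, 0, 1) = η(0)`, where `η(s) = (1 - 2 ^ (1 - s)) ζ(s)`. -/
theorem lerchPhi_neg_one_zero_one :
    ((lerchPhi (-1) 0 1 : ℝ) : ℂ) = (1 - 2 ^ (1 - 0 : ℂ)) * riemannZeta 0 := by
  rw [riemannZeta_zero, lerchPhi]
  norm_num

/-- `Θ(c, q, s, r) = Φ(c, q, s / r) + c (-1) ^ q Φ(c, q, (r - s) / r)`. For `c = q = 1`, where both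
series diverge, `Θ(1, 1, s, r) = π cot (π s / r)` (the value of the corresponding principal value
integral). -/
def lerchTheta (c : ℝ) (q : ℕ) (s r : ℝ) : ℝ :=
  if c = 1 ∧ q = 1 then Real.pi * Real.cot (Real.pi * s / r)
  else lerchPhi c q (s / r) + c * (-1) ^ q * lerchPhi c q ((r - s) / r)

/-- The generalized (skew-)harmonic number `∑_{m = 1}^{k} b ^ (m - 1) / m ^ p`. -/
def genHarmonic (p : ℕ) (b : ℝ) (k : ℕ) : ℝ :=
  ∑ m ∈ Icc 1 k, b ^ (m - 1) / (m : ℝ) ^ p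

end

/-! Put u(l) = b^l / l^p and v(m) = a^m / m^q on the integers, with value 0 at 0, and sum u(l) v(m)
over the half-plane m > n l in two orders. By parity p and q are not both 1, so one factor is
absolutely summable; `exists_tendsto_lattice_sum` then shows that the two orders agree, even where
the other factor converges only conditionally.

By columns: for m in the block (n(x-1), nx] the condition reads l < x, and the sum over l is a value
of the primitive of u. The reflection (l, m) ↦ (-l, -m) changes the sign of u(l) v(m) because p + q
is odd. Folding along it (`balancedSum_blockSum_mul_eq`) leaves twice the wanted series, up to the
factor ab, together with a product of one-sided series and the diagonal m = n l.

By lines m - n l = i > 0: partial fractions (`regPow_mul_regPow`) for X = -n l and Y = m, where X +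
Y = i, separate powers of X and of Y from powers of i. With i = n(r+1) - t and 0 ≤ t < n, the sum
over l is a two-sided Lerch series of sign c = a^n b, centred at 0 or at t/n. It gives 2cΦ(c,k,1) or
0 by parity when centred at 0, and Θ when t > 0. The remaining sums, over i or over r, give Φ(a,·,1)
and Φ(b,·,1-t/n); see `tendsto_sum_tsum_lerchTerm_mul_blockSum`.

The points l = 0 and m = 0 are poles of the partial fractions. Their correction is a term of order 0
equal to minus an indicator function; its sum -1 equals 2cΦ(c,0,1) for both signs c, which is how
ζ(0) and η(0) enter. -/

/-! ### Balanced sums over the integers. -/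

/-- The sum of `f` over the integers in `(-N, N]`. -/
def balancedSum (f : ℤ → ℝ) (N : ℕ) : ℝ := ∑ k ∈ range N, (f (k + 1) + f (-k))

theorem balancedSum_add (f g : ℤ → ℝ) (N : ℕ) :
    balancedSum (fun l => f l + g l) N = balancedSum f N + balancedSum g N := by
  simp only [balancedSum, ← sum_add_distrib]
  exact sum_congr rfl fun k _ => by ring

theorem balancedSum_mul_left (r : ℝ) (f : ℤ → ℝ) (N : ℕ) :
    balancedSum (fun l => r * f l) N = r * balancedSum f N := by
  simp only [balancedSum, mul_sum]
  exact sum_congr rfl fun k _ => by ring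

theorem balancedSum_finset_sum {ι : Type*} (s : Finset ι) (f : ι → ℤ → ℝ) (N : ℕ) :
    balancedSum (fun l => ∑ i ∈ s, f i l) N = ∑ i ∈ s, balancedSum (f i) N := by
  simp only [balancedSum]
  rw [sum_comm]
  exact sum_congr rfl fun k _ => by rw [sum_add_distrib]

theorem balancedSum_shift_one (f : ℤ → ℝ) (N : ℕ) :
    balancedSum (fun l => f (l + 1)) N = balancedSum f N + f (N + 1) - f (-N + 1) := by
  induction N with
  | zero => simp [balancedSum]
  | succ N ih =>
    simp only [balancedSum, sum_range_succ] at ih ⊢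
    rw [ih]
    push_cast
    rw [show -((N : ℤ) + 1) + 1 = -N by ring]
    ring

theorem tendsto_balancedSum_tsum {f : ℤ → ℝ} (hf : Summable f) :
    Tendsto (balancedSum f) atTop (𝓝 (∑' l, f l)) := by
  have h1 : Summable fun n : ℕ => f (n + 1) :=
    hf.comp_injective (i := fun n : ℕ => (n : ℤ) + 1) fun a b h => by simpa using h
  have h2 : Summable fun n : ℕ => f (-n) :=
    hf.comp_injective (i := fun n : ℕ => -(n : ℤ)) fun a b h => by simpa using h
  have h3 : Summable fun n : ℕ => f n :=
    hf.comp_injective (i := fun n : ℕ => (n : ℤ)) fun a b h => by simpa using h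
  have h4 : Summable fun n : ℕ => f (-(n + 1)) := by
    have := (summable_nat_add_iff 1).2 h2
    simpa using this
  have key : ∑' l, f l = ∑' n : ℕ, (f (n + 1) + f (-n)) := by
    rw [tsum_of_nat_of_neg_add_one h3 h4, h1.tsum_add h2, h3.tsum_eq_zero_add,
      h2.tsum_eq_zero_add]
    push_cast
    simp only [neg_zero]
    ring
  rw [key]
  exact (h1.add h2).hasSum.tendsto_sum_nat

/-- Each unit shift changes a balanced sum only by two end terms, which tend to 0. This makes
translation legitimate for series without absolute convergence. -/
theorem tendsto_balancedSum_shift {f : ℤ → ℝ} (htop : Tendsto f atTop (𝓝 0))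
    (hbot : Tendsto f atBot (𝓝 0)) {s : ℝ} (hs : Tendsto (balancedSum f) atTop (𝓝 s)) (r : ℕ) :
    Tendsto (balancedSum fun l => f (l + r)) atTop (𝓝 s) := by
  have hN : Tendsto (fun N : ℕ => (N : ℤ)) atTop atTop := tendsto_natCast_atTop_atTop
  induction r with
  | zero => simpa using hs
  | succ r ih =>
    have h1 : Tendsto (fun N : ℕ => f ((N : ℤ) + 1 + r)) atTop (𝓝 0) :=
      htop.comp (tendsto_atTop_add_const_right _ _ (tendsto_atTop_add_const_right _ _ hN))
    have h2 : Tendsto (fun N : ℕ => f (-(N : ℤ) + 1 + r)) atTop (𝓝 0) :=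
      hbot.comp (tendsto_atBot_add_const_right _ _ (tendsto_atBot_add_const_right _ _
        (tendsto_neg_atTop_atBot.comp hN)))
    have h3 := (ih.add h1).sub h2
    rw [add_zero, sub_zero] at h3
    refine h3.congr fun N => ?_
    rw [← balancedSum_shift_one (fun l => f (l + r))]
    refine congrArg (balancedSum · N) (funext fun l => ?_)
    push_cast
    ring_nf

/-! ### Discrete primitives and domination by a summable factor. -/

/-- The primitive `x ↦ ∑_{0 < y ≤ x} f y` of a function on the integers, normalised by its value
`0` at `0`. -/
def intPrimitive (f : ℤ → ℝ) : ℤ → ℝ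
  | Int.ofNat n => ∑ k ∈ range n, f (k + 1)
  | Int.negSucc n => -∑ k ∈ range (n + 1), f (-k)

theorem intPrimitive_natCast (f : ℤ → ℝ) (n : ℕ) :
    intPrimitive f n = ∑ k ∈ range n, f (k + 1) := rfl

theorem intPrimitive_neg_natCast (f : ℤ → ℝ) (n : ℕ) :
    intPrimitive f (-n) = -∑ k ∈ range n, f (-k) := by
  cases n with
  | zero => simpa using intPrimitive_natCast f 0
  | succ n => rfl

theorem intPrimitive_add_one (f : ℤ → ℝ) (x : ℤ) :
    intPrimitive f (x + 1) = intPrimitive f x + f (x + 1) := by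
  obtain ⟨n, rfl | rfl⟩ := x.eq_nat_or_neg
  · rw [show (n : ℤ) + 1 = ((n + 1 : ℕ) : ℤ) by push_cast; ring, intPrimitive_natCast,
      intPrimitive_natCast, sum_range_succ]
    push_cast
    ring
  · cases n with
    | zero =>
      rw [show -((0 : ℕ) : ℤ) + 1 = ((1 : ℕ) : ℤ) by simp, intPrimitive_natCast,
        intPrimitive_neg_natCast]
      simp
    | succ n =>
      rw [show -((n + 1 : ℕ) : ℤ) + 1 = -(n : ℤ) by push_cast; ring, intPrimitive_neg_natCast,
        intPrimitive_neg_natCast, sum_range_succ]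
      ring

theorem tendsto_int_atTop_iff {f : ℤ → ℝ} {l : Filter ℝ} :
    Tendsto f atTop l ↔ Tendsto (fun n : ℕ => f n) atTop l := by
  rw [← Nat.map_cast_int_atTop, tendsto_map'_iff]
  rfl

theorem tendsto_int_atBot_iff {f : ℤ → ℝ} {l : Filter ℝ} :
    Tendsto f atBot l ↔ Tendsto (fun n : ℕ => f (-n)) atTop l := by
  rw [← tendsto_int_atTop_iff (f := fun x => f (-x))]
  constructor
  · intro h
    exact h.comp tendsto_neg_atTop_atBot
  · intro h
    simpa [Function.comp_def] using h.comp tendsto_neg_atBot_atTop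

theorem exists_abs_le_of_tendsto_int {f : ℤ → ℝ} {s t : ℝ} (htop : Tendsto f atTop (𝓝 s))
    (hbot : Tendsto f atBot (𝓝 t)) : ∃ C, ∀ x, |f x| ≤ C := by
  obtain ⟨A, hA⟩ := (Metric.isBounded_range_of_tendsto _
    (tendsto_int_atTop_iff.1 htop)).exists_norm_le
  obtain ⟨B, hB⟩ := (Metric.isBounded_range_of_tendsto _
    (tendsto_int_atBot_iff.1 hbot)).exists_norm_le
  refine ⟨max A B, fun x => ?_⟩
  obtain ⟨n, rfl | rfl⟩ := x.eq_nat_or_neg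
  · exact (hA _ ⟨n, rfl⟩).trans (le_max_left _ _)
  · exact (hB _ ⟨n, rfl⟩).trans (le_max_right _ _)

theorem summable_mul_of_abs_le {f g : ℤ → ℝ} {C : ℝ} (hf : Summable f) (hg : ∀ x, |g x| ≤ C) :
    Summable fun x => f x * g x := by
  refine Summable.of_norm_bounded (hf.abs.mul_right C) fun x => ?_
  rw [Real.norm_eq_abs, abs_mul]
  exact mul_le_mul_of_nonneg_left (hg x) (abs_nonneg _)

theorem tendsto_tsum_mul_of_abs_le {f : ℤ → ℝ} {G : ℕ → ℤ → ℝ} {g : ℤ → ℝ} {C : ℝ}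
    (hf : Summable f) (hG : ∀ N x, |G N x| ≤ C)
    (hlim : ∀ x, Tendsto (fun N => G N x) atTop (𝓝 (g x))) :
    Tendsto (fun N => ∑' x, f x * G N x) atTop (𝓝 (∑' x, f x * g x)) := by
  refine tendsto_tsum_of_dominated_convergence (hf.abs.mul_right C)
    (fun x => (hlim x).const_mul _) (Eventually.of_forall fun N x => ?_)
  rw [Real.norm_eq_abs, abs_mul]
  exact mul_le_mul_of_nonneg_left (hG N x) (abs_nonneg _)

/-! ### Exchanging the order of summation over a half-plane. -/

section Lattice

variable {u w U W : ℤ → ℝ}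

theorem sub_eq_sum_range_of_primitive (hU : ∀ x, U (x + 1) = U x + u (x + 1)) (x : ℤ) (N : ℕ) :
    U (x + N) - U x = ∑ k ∈ range N, u (x + k + 1) := by
  induction N with
  | zero => simp
  | succ N ih =>
    rw [sum_range_succ, ← ih]
    push_cast
    rw [← add_assoc, hU]
    ring

theorem abs_primitive_sub_le {C : ℝ} (hC : ∀ x, |U x| ≤ C) (x y : ℤ) : |U x - U y| ≤ 2 * C := by
  have := abs_sub (U x) (U y)
  linarith [hC x, hC y]

theorem abs_le_of_primitive (hU : ∀ x, U (x + 1) = U x + u (x + 1)) {C : ℝ}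
    (hC : ∀ x, |U x| ≤ C) (x : ℤ) : |u x| ≤ 2 * C := by
  have h : u x = U x - U (x - 1) := by
    have := hU (x - 1)
    rw [sub_add_cancel] at this
    linarith
  rw [h]
  exact abs_primitive_sub_le hC _ _

/-- Summation by parts: w(x) (U(x-1) - m) + u(x) W(x) is the increment of W (U - m) from x - 1 to x.
-/
theorem balancedSum_mul_primitive (hU : ∀ x, U (x + 1) = U x + u (x + 1))
    (hW : ∀ x, W (x + 1) = W x + w (x + 1)) (m : ℝ) (N : ℕ) :
    balancedSum (fun x => w x * (U (x - 1) - m)) N =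
      W N * (U N - m) - W (-N) * (U (-N) - m) - balancedSum (fun x => u x * W x) N := by
  induction N with
  | zero => simp [balancedSum]
  | succ N ih =>
    simp only [balancedSum, sum_range_succ] at ih ⊢
    rw [ih]
    have h1 := hU N
    have h2 := hW N
    have h3 := hU (-N - 1)
    have h4 := hW (-N - 1)
    rw [sub_add_cancel] at h3 h4
    push_cast
    rw [show -((N : ℤ) + 1) = -N - 1 by ring, h1, h2, h3, h4, add_sub_cancel_right]
    ring

/-- Summation of `u l * w x` over the lattice points with `l < x`, along the lines `x - l = const`
and along the lines `x = const`, when `u` and `w` have convergent primitives and one of them is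
absolutely summable. -/
theorem exists_tendsto_lattice_sum (hU : ∀ x, U (x + 1) = U x + u (x + 1))
    (hW : ∀ x, W (x + 1) = W x + w (x + 1)) {Ut Ub Wt Wb : ℝ}
    (hUt : Tendsto U atTop (𝓝 Ut)) (hUb : Tendsto U atBot (𝓝 Ub))
    (hWt : Tendsto W atTop (𝓝 Wt)) (hWb : Tendsto W atBot (𝓝 Wb))
    (h : Summable u ∨ Summable w) :
    (∀ r : ℤ, Summable fun l => u l * w (l + r)) ∧
    ∃ σ, Tendsto (fun R : ℕ => ∑ r ∈ range R, ∑' l, u l * w (l + (r + 1 : ℕ))) atTop (𝓝 σ) ∧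
      Tendsto (balancedSum fun x => w x * (U (x - 1) - Ub)) atTop (𝓝 σ) := by
  obtain ⟨C, hC⟩ := exists_abs_le_of_tendsto_int hUt hUb
  obtain ⟨D, hD⟩ := exists_abs_le_of_tendsto_int hWt hWb
  have hN : Tendsto (fun N : ℕ => (N : ℤ)) atTop atTop := tendsto_natCast_atTop_atTop
  have hN' : Tendsto (fun N : ℕ => -(N : ℤ)) atTop atBot := tendsto_neg_atTop_atBot.comp hN
  have hS : ∀ r : ℤ, Summable fun l => u l * w (l + r) := by
    intro r
    rcases h with h | h
    · exact summable_mul_of_abs_le h fun x => abs_le_of_primitive hW hD (x + r)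
    · have h' : Summable fun l => w (l + r) := h.comp_injective (add_left_injective r)
      simpa only [mul_comm] using summable_mul_of_abs_le h' (abs_le_of_primitive hU hC)
  refine ⟨hS, ?_⟩
  rcases h with h | h
  -- With u summable, the first R lines telescope in W, and dominated convergence with majorant a
  -- multiple of |u| gives the limit. The column sums follow by parts.
  · have hT : ∀ R : ℕ, ∑ r ∈ range R, ∑' l, u l * w (l + (r + 1 : ℕ)) =
        ∑' l, u l * (W (l + R) - W l) := by
      intro R
      rw [← Summable.tsum_finsetSum fun r _ => hS _]
      refine tsum_congr fun l => ?_
      rw [sub_eq_sum_range_of_primitive hW, mul_sum]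
      refine sum_congr rfl fun r _ => ?_
      push_cast
      rw [add_assoc]
    have hUU : ∑' l, u l = Ut - Ub := by
      refine tendsto_nhds_unique (tendsto_balancedSum_tsum h)
        (((hUt.comp hN).sub (hUb.comp hN')).congr fun N => ?_)
      have : ∀ N : ℕ, U N - U (-N) = balancedSum u N := by
        intro N
        induction N with
        | zero => simp [balancedSum]
        | succ N ih =>
          simp only [balancedSum, sum_range_succ] at ih ⊢
          have h1 := hU N
          have h3 := hU (-N - 1)
          rw [sub_add_cancel] at h3
          push_cast
          rw [← ih, h1, h3, neg_add, ← sub_eq_add_neg]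
          ring
      exact this N
    have hsW : Summable fun l => u l * W l := summable_mul_of_abs_le h hD
    refine ⟨∑' l, u l * (Wt - W l), ?_, ?_⟩
    · simp only [hT]
      refine tendsto_tsum_mul_of_abs_le h (fun N x => abs_primitive_sub_le hD _ _) fun x => ?_
      exact (hWt.comp (tendsto_atTop_add_const_left _ x hN)).sub_const _
    -- The vanishing term `Wb * (Ub - Ub)` is the limit of the lower boundary term of the summation
    -- by parts.
    · have hval : ∑' l, u l * (Wt - W l) = Wt * (Ut - Ub) - Wb * (Ub - Ub) - ∑' l, u l * W l := by
        simp only [mul_sub]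
        rw [(h.mul_right Wt).tsum_sub hsW, tsum_mul_right, hUU]
        ring
      rw [hval]
      refine Tendsto.congr (fun N => (balancedSum_mul_primitive hU hW Ub N).symm) ?_
      exact (((hWt.comp hN).mul ((hUt.comp hN).sub_const _)).sub
        ((hWb.comp hN').mul ((hUb.comp hN').sub_const _))).sub (tendsto_balancedSum_tsum hsW)
  · refine ⟨∑' x, w x * (U (x - 1) - Ub), ?_, ?_⟩
    -- With w summable, the lines are re-indexed by x = l + r + 1, so that they telescope in U
    -- instead.
    · have hT : ∀ R : ℕ, ∑ r ∈ range R, ∑' l, u l * w (l + (r + 1 : ℕ)) =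
          ∑' x, w x * (U (x - 1) - U (x - 1 - R)) := by
        intro R
        have hshift : ∀ r : ℕ, ∑' l, u l * w (l + (r + 1 : ℕ)) =
            ∑' x, w x * u (x - (r + 1 : ℕ)) := by
          intro r
          rw [← (Equiv.addRight ((r + 1 : ℕ) : ℤ)).tsum_eq (fun x => w x * u (x - (r + 1 : ℕ)))]
          refine tsum_congr fun l => ?_
          simp [mul_comm, add_assoc]
        simp only [hshift]
        rw [← Summable.tsum_finsetSum fun r _ =>
          summable_mul_of_abs_le h fun x => abs_le_of_primitive hU hC _]
        refine tsum_congr fun x => ?_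
        have h1 := sub_eq_sum_range_of_primitive hU (x - 1 - R) R
        rw [sub_add_cancel] at h1
        rw [h1, ← mul_sum, ← sum_range_reflect]
        congr 1
        refine sum_congr rfl fun r hr => ?_
        have := mem_range.1 hr
        congr 1
        omega
      simp only [hT]
      refine tendsto_tsum_mul_of_abs_le h (fun N x => abs_primitive_sub_le hC _ _) fun x => ?_
      refine ((hUb.comp ?_).const_sub _)
      simpa only [sub_eq_add_neg] using tendsto_atBot_add_const_left _ (x - 1) hN'
    · refine tendsto_balancedSum_tsum (summable_mul_of_abs_le (C := C + |Ub|) h fun x => ?_)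
      exact (abs_sub _ _).trans (add_le_add (hC _) le_rfl)

end Lattice

/-! ### Partial fractions, including the poles. -/

/-- `∑_{k ≤ P} C(Q + k, Q) w ^ (Q + 1 + k) u ^ (P + 1 - k)`, the part at one of the two poles of the
partial fraction decomposition of `u ^ (P + 1) * v ^ (Q + 1)` when `u * v = w * (u + v)`. -/
noncomputable def polarPart (u w : ℝ) (P Q : ℕ) : ℝ :=
  ∑ k ∈ range (P + 1), ((Q + k).choose Q : ℝ) * w ^ (Q + 1 + k) * u ^ (P + 1 - k)

theorem polarPart_zero_left (u w : ℝ) (Q : ℕ) : polarPart u w 0 Q = w ^ (Q + 1) * u := by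
  simp [polarPart]

theorem polarPart_succ_zero (u w : ℝ) (P : ℕ) :
    polarPart u w (P + 1) 0 = w * u ^ (P + 2) + w * polarPart u w P 0 := by
  simp only [polarPart]
  rw [sum_range_succ', add_comm, mul_sum]
  simp only [Nat.choose_zero_right, Nat.cast_one, one_mul]
  congr 1
  · simp
  · refine sum_congr rfl fun k _ => ?_
    rw [show P + 1 + 1 - (k + 1) = P + 1 - k by omega]
    ring

theorem polarPart_succ_succ (u w : ℝ) (P Q : ℕ) :
    polarPart u w (P + 1) (Q + 1) =
      w * (polarPart u w P (Q + 1) + polarPart u w (P + 1) Q) := by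
  simp only [polarPart]
  rw [sum_range_succ' _ (P + 1), sum_range_succ' _ (P + 1), mul_add, mul_add, ← add_assoc, mul_sum,
    mul_sum, ← sum_add_distrib]
  congr 1
  · refine sum_congr rfl fun k _ => ?_
    rw [show P + 1 + 1 - (k + 1) = P + 1 - k by omega,
      show Q + 1 + (k + 1) = (Q + k + 1) + 1 by ring, Nat.choose_succ_succ,
      show Q + 1 + k = Q + k + 1 by ring, show Q + (k + 1) = Q + k + 1 by ring]
    push_cast
    ring
  · simp
    ring

/-- Replacing one factor u v by w (u + v) lowers one exponent at a time; by Pascal's rule the polar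
parts obey the same recursion. -/
theorem pow_mul_pow_eq_polarPart {u v w : ℝ} (h : u * v = w * (u + v)) (P Q : ℕ) :
    u ^ (P + 1) * v ^ (Q + 1) = polarPart u w P Q + polarPart v w Q P := by
  induction P generalizing Q with
  | zero =>
    induction Q with
    | zero =>
      rw [polarPart_zero_left, polarPart_zero_left]
      linear_combination h
    | succ Q ih =>
      rw [polarPart_zero_left, polarPart_succ_zero]
      rw [polarPart_zero_left] at ih
      linear_combination v ^ (Q + 1) * h + w * ih
  | succ P ihP =>
    induction Q with
    | zero =>
      have := ihP 0
      rw [polarPart_zero_left] at this ⊢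
      rw [polarPart_succ_zero]
      linear_combination u ^ (P + 1) * h + w * this
    | succ Q ihQ =>
      rw [polarPart_succ_succ, polarPart_succ_succ]
      have := ihP (Q + 1)
      linear_combination u ^ (P + 1) * v ^ (Q + 1) * h + w * this + w * ihQ

theorem polarPart_self (w : ℝ) (P Q : ℕ) :
    polarPart w w P Q = ((P + Q + 1).choose (Q + 1) : ℝ) * w ^ (P + Q + 2) := by
  rw [polarPart, ← Nat.sum_range_add_choose, Nat.cast_sum, sum_mul]
  refine sum_congr rfl fun k hk => ?_
  have := mem_range.1 hk
  rw [mul_assoc, ← pow_add, add_comm Q k]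
  congr 2
  omega

theorem polarPart_zero (w : ℝ) (P Q : ℕ) : polarPart 0 w P Q = 0 := by
  refine sum_eq_zero fun k hk => ?_
  have := mem_range.1 hk
  rw [zero_pow (by omega), mul_zero]

/-- Partial fractions of `X⁻ᵖ Y⁻ᵠ` for `X + Y = i`, with `0⁻¹ = 0`. -/
theorem inv_pow_mul_inv_pow {X Y i : ℝ} (h : X + Y = i) (hi : i ≠ 0) (P Q : ℕ) :
    X⁻¹ ^ (P + 1) * Y⁻¹ ^ (Q + 1) = polarPart X⁻¹ i⁻¹ P Q + polarPart Y⁻¹ i⁻¹ Q P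
      - (if X = 0 then ((P + Q + 1).choose (P + 1) : ℝ) * i⁻¹ ^ (P + Q + 2) else 0)
      - (if Y = 0 then ((P + Q + 1).choose (Q + 1) : ℝ) * i⁻¹ ^ (P + Q + 2) else 0) := by
  by_cases hX : X = 0
  · have hY : Y = i := by rw [← h, hX, zero_add]
    -- At X = 0 the left side vanishes and Y = i, so the polar part at Y degenerates to a single
    -- binomial term, which the correction cancels.
    rw [if_pos hX, if_neg (hY ▸ hi), hX, hY, inv_zero, polarPart_zero, polarPart_self,
      zero_pow (by omega), add_comm Q P]
    ring
  · by_cases hY : Y = 0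
    · have hX' : X = i := by rw [← h, hY, add_zero]
      rw [if_pos hY, if_neg hX, hX', hY, inv_zero, polarPart_zero, polarPart_self,
        zero_pow (by omega)]
      ring
    · rw [if_neg hX, if_neg hY, pow_mul_pow_eq_polarPart (w := i⁻¹)]
      · ring
      · rw [← h] at hi ⊢
        field_simp
        ring

/-- The power `X⁻ᵏ` for `k ≠ 0`, with value `0` at `X = 0`; for `k = 0`, minus the indicator
of `X = 0`. -/
noncomputable def regPow (k : ℕ) (X : ℝ) : ℝ := if k = 0 then (if X = 0 then -1 else 0) else X⁻¹ ^ k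

theorem regPow_of_ne_zero {k : ℕ} (hk : k ≠ 0) (X : ℝ) : regPow k X = X⁻¹ ^ k := if_neg hk

theorem regPow_zero (X : ℝ) : regPow 0 X = if X = 0 then -1 else 0 := if_pos rfl

theorem regPow_mul {r : ℝ} (hr : r ≠ 0) (k : ℕ) (X : ℝ) :
    regPow k (r * X) = r⁻¹ ^ k * regPow k X := by
  by_cases hk : k = 0
  · subst hk
    simp [regPow_zero, hr]
  · rw [regPow_of_ne_zero hk, regPow_of_ne_zero hk, mul_inv, mul_pow]

/-- The terms k ≥ 1 form the polar part in reverse order; the term k = 0 is the pole correction, by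
the symmetry of the binomial coefficient. -/
theorem sum_regPow_eq_polarPart (X i : ℝ) (P Q : ℕ) :
    ∑ k ∈ range (P + 2), ((P + 1 + (Q + 1) - k - 1).choose Q : ℝ) * i⁻¹ ^ (P + 1 + (Q + 1) - k) *
      regPow k X = polarPart X⁻¹ i⁻¹ P Q
        - (if X = 0 then ((P + Q + 1).choose (P + 1) : ℝ) * i⁻¹ ^ (P + Q + 2) else 0) := by
  rw [sum_range_succ', regPow_zero, polarPart, ← sum_range_reflect, sub_eq_add_neg]
  congr 1
  · refine sum_congr rfl fun k hk => ?_
    have := mem_range.1 hk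
    rw [regPow_of_ne_zero (Nat.succ_ne_zero _),
      show P + 1 + (Q + 1) - (P + 1 - 1 - k + 1) = Q + 1 + k by omega,
      show (P + 1 - 1 - k).succ = P + 1 - k by omega, show Q + 1 + k - 1 = Q + k by omega]
  · split_ifs
    · rw [show P + 1 + (Q + 1) - 0 = P + Q + 2 by omega,
        show P + Q + 2 - 1 = P + Q + 1 by omega,
        ← Nat.choose_symm_of_eq_add (show P + Q + 1 = P + 1 + Q by ring)]
      ring
    · ring

/-- Partial fractions of `X⁻ᵖ Y⁻ᵠ` for `X + Y = i`, valid also at the two poles. -/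
theorem regPow_mul_regPow {X Y i : ℝ} (h : X + Y = i) (hi : i ≠ 0) {p q : ℕ} (hp : 1 ≤ p)
    (hq : 1 ≤ q) :
    regPow p X * regPow q Y =
      ∑ k ∈ range (p + 1), ((p + q - k - 1).choose (q - 1) : ℝ) * i⁻¹ ^ (p + q - k) * regPow k X +
      ∑ k ∈ range (q + 1), ((p + q - k - 1).choose (p - 1) : ℝ) * i⁻¹ ^ (p + q - k) *
        regPow k Y := by
  obtain ⟨P, rfl⟩ := Nat.exists_eq_add_of_le' hp
  obtain ⟨Q, rfl⟩ := Nat.exists_eq_add_of_le' hq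
  have h2 := sum_regPow_eq_polarPart Y i Q P
  rw [add_comm (Q + 1) (P + 1), add_comm Q P] at h2
  rw [regPow_of_ne_zero (Nat.succ_ne_zero P), regPow_of_ne_zero (Nat.succ_ne_zero Q),
    inv_pow_mul_inv_pow h hi, Nat.add_sub_cancel, Nat.add_sub_cancel, sum_regPow_eq_polarPart, h2]
  ring

/-! ### Two-sided Lerch series. -/

/-- The term `cˡ (l + x)⁻ᵏ` of a two-sided Lerch series. -/
noncomputable def lerchTerm (c : ℝ) (k : ℕ) (x : ℝ) (l : ℤ) : ℝ := c ^ l * regPow k (l + x)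

section Sign

variable {c : ℝ}

theorem sign_mul_sign (hc : c = 1 ∨ c = -1) : c * c = 1 := by rcases hc with rfl | rfl <;> norm_num

theorem sign_ne_zero_real (hc : c = 1 ∨ c = -1) : c ≠ 0 := by rcases hc with rfl | rfl <;> norm_num

theorem abs_sign_zpow (hc : c = 1 ∨ c = -1) (l : ℤ) : |c ^ l| = 1 := by
  rcases hc with rfl | rfl <;> simp [abs_zpow]

theorem sign_zpow_neg (hc : c = 1 ∨ c = -1) (l : ℤ) : c ^ (-l) = c ^ l := by
  rcases hc with rfl | rfl
  · simp
  · rw [zpow_neg, ← inv_zpow, inv_neg, inv_one]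

end Sign

theorem tendsto_lerchPhi {c : ℝ} (hc : c = 1 ∨ c = -1) {k : ℕ} (hk : k ≠ 0)
    (hck : ¬(c = 1 ∧ k = 1)) {α : ℝ} (hα : 0 < α) :
    Tendsto (fun N : ℕ => ∑ n ∈ range N, c ^ n / ((n : ℝ) + α) ^ k) atTop
      (𝓝 (lerchPhi c k α)) := by
  suffices h : ∃ l, Tendsto (fun N : ℕ => ∑ n ∈ range N, c ^ n / ((n : ℝ) + α) ^ k) atTop (𝓝 l) by
    obtain ⟨l, hl⟩ := h
    rwa [lerchPhi_eq_of_tendsto hk hl]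
  rcases hc with rfl | rfl
  · have hk2 : 1 < k := by
      have : k ≠ 1 := fun h => hck ⟨rfl, h⟩
      omega
    have hs : Summable fun n : ℕ => 1 ^ n / ((n : ℝ) + α) ^ k := by
      refine ((Real.summable_one_div_nat_add_rpow α k).2 (by exact_mod_cast hk2)).congr fun n => ?_
      rw [Real.rpow_natCast, abs_of_pos (by positivity), one_pow]
    exact ⟨_, hs.hasSum.tendsto_sum_nat⟩
  · obtain ⟨l, hl⟩ := Antitone.tendsto_alternating_series_of_tendsto_zero
      (f := fun n : ℕ => 1 / ((n : ℝ) + α) ^ k) (fun m n hmn => by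
        have : (m : ℝ) ≤ n := by exact_mod_cast hmn
        dsimp only
        gcongr)
      (tendsto_const_nhds.div_atTop ((tendsto_pow_atTop hk).comp
        (tendsto_atTop_add_const_right _ _ tendsto_natCast_atTop_atTop)))
    refine ⟨l, hl.congr fun N => sum_congr rfl fun n _ => ?_⟩
    ring

theorem tendsto_regPow_atTop (k : ℕ) : Tendsto (regPow k) atTop (𝓝 0) := by
  by_cases hk : k = 0
  · refine tendsto_const_nhds.congr' ?_
    filter_upwards [eventually_gt_atTop 0] with x hx
    rw [hk, regPow_zero, if_neg hx.ne']
  · have : regPow k = fun X => X⁻¹ ^ k := funext (regPow_of_ne_zero hk)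
    rw [this, ← zero_pow hk]
    exact tendsto_inv_atTop_zero.pow k

theorem tendsto_regPow_atBot (k : ℕ) : Tendsto (regPow k) atBot (𝓝 0) := by
  by_cases hk : k = 0
  · refine tendsto_const_nhds.congr' ?_
    filter_upwards [eventually_lt_atBot 0] with x hx
    rw [hk, regPow_zero, if_neg hx.ne]
  · have : regPow k = fun X => X⁻¹ ^ k := funext (regPow_of_ne_zero hk)
    rw [this, ← zero_pow hk]
    exact tendsto_inv_atBot_zero.pow k

section LerchTerm

variable {c : ℝ}

theorem abs_lerchTerm (hc : c = 1 ∨ c = -1) (k : ℕ) (x : ℝ) (l : ℤ) :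
    |lerchTerm c k x l| = |regPow k (l + x)| := by
  rw [lerchTerm, abs_mul, abs_sign_zpow hc, one_mul]

theorem tendsto_lerchTerm_atTop (hc : c = 1 ∨ c = -1) (k : ℕ) (x : ℝ) :
    Tendsto (lerchTerm c k x) atTop (𝓝 0) := by
  rw [tendsto_zero_iff_abs_tendsto_zero]
  refine Tendsto.congr (fun l => (abs_lerchTerm hc k x l).symm) ?_
  have := (tendsto_regPow_atTop k).comp (tendsto_atTop_add_const_right _ x
    (tendsto_intCast_atTop_atTop (R := ℝ)))
  simpa using this.abs

theorem tendsto_lerchTerm_atBot (hc : c = 1 ∨ c = -1) (k : ℕ) (x : ℝ) :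
    Tendsto (lerchTerm c k x) atBot (𝓝 0) := by
  rw [tendsto_zero_iff_abs_tendsto_zero]
  refine Tendsto.congr (fun l => (abs_lerchTerm hc k x l).symm) ?_
  have := (tendsto_regPow_atBot k).comp (tendsto_atBot_add_const_right _ x
    ((tendsto_intCast_atBot_iff (R := ℝ)).2 tendsto_id))
  simpa using this.abs

theorem summable_lerchTerm (hc : c = 1 ∨ c = -1) {k : ℕ} (hk : 1 < k) :
    Summable (lerchTerm c k 0) := by
  refine Summable.of_abs (((Real.summable_one_div_int_pow (p := k)).2 hk).abs.congr fun l => ?_)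
  rw [abs_lerchTerm hc, regPow_of_ne_zero (by omega), add_zero, inv_pow, one_div]

theorem lerchTerm_natCast_add_one {k : ℕ} (hk : k ≠ 0) (x : ℝ) (m : ℕ) :
    lerchTerm c k x (m + 1) = c * (c ^ m / (m + (1 + x)) ^ k) := by
  rw [lerchTerm, regPow_of_ne_zero hk, ← Nat.cast_succ, zpow_natCast, Nat.cast_succ, pow_succ]
  push_cast
  rw [inv_pow, add_assoc]
  ring

theorem lerchTerm_neg_natCast (hc : c = 1 ∨ c = -1) {k : ℕ} (hk : k ≠ 0) (x : ℝ) (m : ℕ) :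
    lerchTerm c k x (-m) = (-1) ^ k * (c ^ m / (m + (-x)) ^ k) := by
  rw [lerchTerm, regPow_of_ne_zero hk, sign_zpow_neg hc, zpow_natCast]
  push_cast
  rw [show -(m : ℝ) + x = -(m + -x) by ring, inv_neg, neg_pow, inv_pow]
  ring

theorem lerchTerm_neg (hc : c = 1 ∨ c = -1) {k : ℕ} (hk : k ≠ 0) (l : ℤ) :
    lerchTerm c k 0 (-l) = (-1) ^ k * lerchTerm c k 0 l := by
  rw [lerchTerm, lerchTerm, regPow_of_ne_zero hk, regPow_of_ne_zero hk, sign_zpow_neg hc]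
  push_cast
  rw [add_zero, add_zero, inv_neg, neg_pow]
  ring

theorem lerchTerm_zero_zero {k : ℕ} (hk : k ≠ 0) : lerchTerm c k 0 0 = 0 := by
  simp [lerchTerm, regPow_of_ne_zero hk, hk]

theorem tendsto_sum_lerchTerm_add_one (hc : c = 1 ∨ c = -1) {k : ℕ} (hk : k ≠ 0)
    (hck : ¬(c = 1 ∧ k = 1)) {x : ℝ} (hx : -1 < x) :
    Tendsto (fun N : ℕ => ∑ m ∈ range N, lerchTerm c k x (m + 1)) atTop
      (𝓝 (c * lerchPhi c k (1 + x))) := by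
  simp only [lerchTerm_natCast_add_one hk, ← mul_sum]
  exact (tendsto_lerchPhi hc hk hck (by linarith)).const_mul c

theorem tendsto_sum_lerchTerm_neg (hc : c = 1 ∨ c = -1) {k : ℕ} (hk : k ≠ 0)
    (hck : ¬(c = 1 ∧ k = 1)) {x : ℝ} (hx : x < 0) :
    Tendsto (fun N : ℕ => ∑ m ∈ range N, lerchTerm c k x (-m)) atTop
      (𝓝 ((-1) ^ k * lerchPhi c k (-x))) := by
  simp only [lerchTerm_neg_natCast hc hk, ← mul_sum]
  exact (tendsto_lerchPhi hc hk hck (by linarith)).const_mul _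

theorem sum_lerchTerm_neg_natCast (hc : c = 1 ∨ c = -1) {k : ℕ} (hk : k ≠ 0) (N : ℕ) :
    ∑ m ∈ range N, lerchTerm c k 0 (-m) =
      (-1) ^ k * (∑ m ∈ range N, lerchTerm c k 0 (m + 1) - lerchTerm c k 0 N) := by
  induction N with
  | zero => simp [lerchTerm_zero_zero hk]
  | succ N ih =>
    rw [sum_range_succ, sum_range_succ, ih, lerchTerm_neg hc hk]
    push_cast
    ring

/-- The reflection l ↦ -l multiplies the terms of order k ≥ 1 by (-1)^k, so the two halves double or
cancel. Cancellation also covers c = k = 1, where each half diverges. -/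
theorem tendsto_balancedSum_lerchTerm_zero (hc : c = 1 ∨ c = -1) (k : ℕ) :
    Tendsto (balancedSum (lerchTerm c k 0)) atTop
      (𝓝 (if Even k then 2 * c * lerchPhi c k 1 else 0)) := by
  by_cases hk : k = 0
  -- For order 0 only l = 0 contributes, with value -1; the continued values 2ζ(0) and -2η(0) are
  -- both -1.
  · have hval : (if Even k then 2 * c * lerchPhi c k 1 else 0) = -1 := by
      rcases hc with rfl | rfl <;> norm_num [hk, lerchPhi]
    rw [hval]
    refine tendsto_const_nhds.congr' ?_
    filter_upwards [eventually_gt_atTop 0] with N hN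
    obtain ⟨M, rfl⟩ := Nat.exists_eq_add_of_le' hN
    rw [balancedSum, sum_eq_single_of_mem 0 (mem_range.2 hN)]
    · simp [lerchTerm, hk, regPow_zero]
    · intro m _ hm
      have h1 : (m : ℝ) + 1 ≠ 0 := by positivity
      simp [lerchTerm, hk, regPow_zero, hm, h1]
  · have hlim : Tendsto (fun N : ℕ => lerchTerm c k 0 N) atTop (𝓝 0) :=
      tendsto_int_atTop_iff.1 (tendsto_lerchTerm_atTop hc k 0)
    have hsum : ∀ N, balancedSum (lerchTerm c k 0) N =
        (1 + (-1) ^ k) * ∑ m ∈ range N, lerchTerm c k 0 (m + 1)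
          - (-1) ^ k * lerchTerm c k 0 N := by
      intro N
      rw [balancedSum, sum_add_distrib, sum_lerchTerm_neg_natCast hc hk]
      ring
    rw [show balancedSum (lerchTerm c k 0) = _ from funext hsum]
    split_ifs with hev
    · have hk1 : ¬(c = 1 ∧ k = 1) := by
        rintro ⟨-, rfl⟩
        exact absurd hev (by decide)
      have := ((tendsto_sum_lerchTerm_add_one hc hk hk1 (x := 0) (by norm_num)).const_mul
        (1 + (-1) ^ k)).sub (hlim.const_mul ((-1) ^ k))
      convert this using 2
      rw [hev.neg_one_pow, add_zero]
      ring
    · rw [(Nat.not_even_iff_odd.1 hev).neg_one_pow]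
      simpa using hlim

/-- The Mittag-Leffler expansion of the cotangent, regrouped: the partial sums differ from the
symmetric ones by 1/x and by 1/(N + x), which tends to 0. -/
theorem tendsto_sum_cot {x : ℝ} (h0 : 0 < x) (h1 : x < 1) :
    Tendsto (fun N : ℕ => ∑ m ∈ range N, (1 / ((m : ℝ) + x) - 1 / (m + (1 - x)))) atTop
      (𝓝 (Real.pi * Real.cot (Real.pi * x))) := by
  have hx : (x : ℂ) ∈ Complex.integerComplement := by
    rintro ⟨m, hm⟩
    have hm' : (m : ℝ) = x := by exact_mod_cast hm
    rw [← hm'] at h0 h1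
    have h0' : 0 < m := by exact_mod_cast h0
    have h1' : m < 1 := by exact_mod_cast h1
    omega
  have h := tendsto_logDeriv_euler_cot_sub hx
  have hre : Tendsto (fun N : ℕ => ∑ m ∈ range N, (1 / (x - (m + 1)) + 1 / (x + (m + 1)))) atTop
      (𝓝 (Real.pi * Real.cot (Real.pi * x) - 1 / x)) := by
    rw [← tendsto_ofReal_iff]
    push_cast
    exact h
  have hz : Tendsto (fun N : ℕ => 1 / ((N : ℝ) + x)) atTop (𝓝 0) :=
    tendsto_const_nhds.div_atTop
      (tendsto_atTop_add_const_right _ _ tendsto_natCast_atTop_atTop)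
  have hsum := (hre.add_const (1 / x)).sub hz
  rw [sub_add_cancel, sub_zero] at hsum
  refine hsum.congr fun N => ?_
  induction N with
  | zero => simp
  | succ N ih =>
    rw [sum_range_succ, sum_range_succ, ← ih]
    push_cast
    rw [show x - ((N : ℝ) + 1) = -(N + (1 - x)) by ring, show x + ((N : ℝ) + 1) = N + 1 + x by ring,
      one_div_neg_eq_neg_one_div]
    ring

/-- The terms with l ≥ 1 give Φ at 1 - t/n and those with l ≤ 0 give Φ at t/n. For c = k = 1 only
the paired terms converge, to a cotangent. -/
theorem tendsto_balancedSum_lerchTerm_neg_div (hc : c = 1 ∨ c = -1) {k t n : ℕ} (hk : k ≠ 0)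
    (ht : 0 < t) (htn : t < n) :
    Tendsto (balancedSum (lerchTerm c k (-(t / n : ℝ)))) atTop
      (𝓝 ((-1) ^ k * lerchTheta c k t n)) := by
  have hn : (0 : ℝ) < n := by exact_mod_cast ht.trans htn
  have h0 : (0 : ℝ) < t / n := by positivity
  have h1 : (t / n : ℝ) < 1 := by
    rw [div_lt_one hn]
    exact_mod_cast htn
  by_cases hck : c = 1 ∧ k = 1
  · rw [lerchTheta, if_pos hck]
    obtain ⟨rfl, rfl⟩ := hck
    have h := (tendsto_sum_cot h0 h1).neg
    rw [mul_div_assoc, pow_one, neg_one_mul]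
    refine h.congr fun N => ?_
    rw [balancedSum, ← sum_neg_distrib]
    refine sum_congr rfl fun m _ => ?_
    rw [lerchTerm_natCast_add_one one_ne_zero, lerchTerm_neg_natCast hc one_ne_zero]
    simp only [one_pow, pow_one, neg_neg]
    ring
  · rw [lerchTheta, if_neg hck]
    have h := (tendsto_sum_lerchTerm_add_one hc hk hck (x := -(t / n : ℝ)) (by linarith)).add
      (tendsto_sum_lerchTerm_neg hc hk hck (x := -(t / n : ℝ)) (by linarith))
    have h' := h.congr fun N => (sum_add_distrib (s := range N)).symm
    convert h' using 2
    · rfl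
    · have h2 : ((n : ℝ) - t) / n = 1 + -(t / n) := by field_simp; ring
      have h3 : ((-1 : ℝ) ^ k) * (-1) ^ k = 1 := by rw [← mul_pow]; norm_num
      rw [h2, neg_neg]
      linear_combination (c * lerchPhi c k (1 + -(t / n : ℝ))) * h3

end LerchTerm

/-! ### Block sums and folding by reflection. -/

/-- The sum of `f` over the block `(n (x - 1), n x]` of `n` consecutive integers. -/
def blockSum (f : ℤ → ℝ) (n : ℕ) (x : ℤ) : ℝ := ∑ t ∈ range n, f (n * x - t)

theorem intPrimitive_mul_add_one (f : ℤ → ℝ) (n : ℕ) (x : ℤ) :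
    intPrimitive f (n * (x + 1)) = intPrimitive f (n * x) + blockSum f n (x + 1) := by
  have h := sub_eq_sum_range_of_primitive (intPrimitive_add_one f) (n * x) n
  rw [← sum_range_reflect] at h
  rw [mul_add, mul_one, ← sub_eq_iff_eq_add', h, blockSum]
  refine sum_congr rfl fun t ht => ?_
  have := mem_range.1 ht
  congr 1
  have h2 : ((n - 1 - t : ℕ) : ℤ) = n - 1 - t := by omega
  rw [h2]
  ring

theorem sum_blockSum_eq_intPrimitive (f : ℤ → ℝ) (n N : ℕ) :
    ∑ k ∈ range N, blockSum f n (k + 1) = intPrimitive f (n * N) := by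
  induction N with
  | zero => simpa using (intPrimitive_natCast f 0).symm
  | succ N ih =>
    rw [sum_range_succ, ih]
    push_cast
    rw [intPrimitive_mul_add_one]

theorem summable_blockSum {f : ℤ → ℝ} (hf : Summable f) {n : ℕ} (hn : n ≠ 0) :
    Summable (blockSum f n) := by
  refine summable_sum fun t _ => hf.comp_injective (i := fun x : ℤ => n * x - t) fun x y h => ?_
  have h' : (n : ℤ) * x = n * y := by simpa using h
  exact mul_left_cancel₀ (by exact_mod_cast hn) h'

theorem intPrimitive_lerchTerm_neg {c : ℝ} (hc : c = 1 ∨ c = -1) {k : ℕ} (hk : k ≠ 0) (N : ℕ) :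
    intPrimitive (lerchTerm c k 0) (-N) =
      -(-1) ^ k * (intPrimitive (lerchTerm c k 0) N - lerchTerm c k 0 N) := by
  rw [intPrimitive_neg_natCast, sum_lerchTerm_neg_natCast hc hk, intPrimitive_natCast]
  ring

theorem tendsto_intPrimitive_lerchTerm_atTop {c : ℝ} (hc : c = 1 ∨ c = -1) {k : ℕ} (hk : k ≠ 0)
    (hck : ¬(c = 1 ∧ k = 1)) :
    Tendsto (intPrimitive (lerchTerm c k 0)) atTop (𝓝 (c * lerchPhi c k 1)) := by
  rw [tendsto_int_atTop_iff]
  simpa [intPrimitive_natCast] using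
    tendsto_sum_lerchTerm_add_one hc hk hck (x := 0) (by norm_num)

theorem tendsto_intPrimitive_lerchTerm_atBot {c : ℝ} (hc : c = 1 ∨ c = -1) {k : ℕ} (hk : k ≠ 0)
    (hck : ¬(c = 1 ∧ k = 1)) :
    Tendsto (intPrimitive (lerchTerm c k 0)) atBot (𝓝 (-(-1) ^ k * (c * lerchPhi c k 1))) := by
  rw [tendsto_int_atBot_iff]
  simp only [intPrimitive_lerchTerm_neg hc hk]
  have h := (tendsto_int_atTop_iff.1 (tendsto_intPrimitive_lerchTerm_atTop hc hk hck)).sub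
    (tendsto_int_atTop_iff.1 (tendsto_lerchTerm_atTop hc k 0))
  rw [sub_zero] at h
  exact h.const_mul _

/-- Reflection turns the block into [nx, n(x+1)), which differs from (nx, n(x+1)] in its two
endpoints. These endpoints produce the diagonal terms of the folding. -/
theorem blockSum_lerchTerm_neg {a : ℝ} (ha : a = 1 ∨ a = -1) {q : ℕ} (hq : q ≠ 0) (n : ℕ) (x : ℤ) :
    blockSum (lerchTerm a q 0) n (-x) = (-1) ^ q * (blockSum (lerchTerm a q 0) n (x + 1)
      - lerchTerm a q 0 (n * (x + 1)) + lerchTerm a q 0 (n * x)) := by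
  have h1 : blockSum (lerchTerm a q 0) n (-x) =
      (-1) ^ q * ∑ t ∈ range n, lerchTerm a q 0 (n * x + t) := by
    rw [blockSum, mul_sum]
    refine sum_congr rfl fun t _ => ?_
    rw [← lerchTerm_neg ha hq]
    ring_nf
  have h2 : blockSum (lerchTerm a q 0) n (x + 1) =
      ∑ t ∈ range n, lerchTerm a q 0 (n * x + (t + 1 : ℕ)) := by
    rw [blockSum, ← sum_range_reflect]
    refine sum_congr rfl fun t ht => ?_
    have := mem_range.1 ht
    congr 1
    have h2 : ((n - 1 - t : ℕ) : ℤ) = n - 1 - t := by omega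
    rw [h2]
    push_cast
    ring
  have h3 := sum_range_succ' (fun t : ℕ => lerchTerm a q 0 (n * x + t)) n
  rw [sum_range_succ] at h3
  simp only [Nat.cast_zero, add_zero] at h3
  rw [h1, h2, mul_add (n : ℤ) x 1, mul_one]
  congr 1
  linarith

/-- Folding the lattice sum over `l < x` by the reflection `(l, m) ↦ (-l, -m)`. -/
theorem balancedSum_blockSum_mul_eq {a b : ℝ} (ha : a = 1 ∨ a = -1) (hb : b = 1 ∨ b = -1)
    {p q : ℕ} (hp : p ≠ 0) (hq : q ≠ 0) (hpq : Odd (p + q)) (n : ℕ) (Z : ℝ) (N : ℕ) :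
    balancedSum (fun x => blockSum (lerchTerm a q 0) n x *
        (intPrimitive (lerchTerm b p 0) (x - 1) - -(-1) ^ p * Z)) N =
      2 * ∑ k ∈ range N, blockSum (lerchTerm a q 0) n (k + 1) * intPrimitive (lerchTerm b p 0) k
      + ((-1) ^ p - 1) * Z * intPrimitive (lerchTerm a q 0) (n * N)
      - lerchTerm a q 0 (n * N) * (intPrimitive (lerchTerm b p 0) N - Z)
      + ∑ k ∈ range N, lerchTerm b p 0 (k + 1) * lerchTerm a q 0 (n * (k + 1)) := by
  have hs : ((-1 : ℝ)) ^ q * (-1) ^ p = -1 := by rw [← pow_add, add_comm, hpq.neg_one_pow]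
  rw [← sum_blockSum_eq_intPrimitive]
  induction N with
  | zero => simp [balancedSum, lerchTerm_zero_zero hq]
  | succ N ih =>
    -- The primitive at -N - 1 is minus the sum over [-N, 0], whose term at 0 vanishes.
    have h1 : intPrimitive (lerchTerm b p 0) (-N - 1) =
        -(-1) ^ p * intPrimitive (lerchTerm b p 0) N := by
      have h := intPrimitive_lerchTerm_neg hb hp (N + 1)
      push_cast at h
      rw [intPrimitive_add_one, add_sub_cancel_right] at h
      rw [← h]
      ring_nf
    simp only [balancedSum, sum_range_succ] at ih ⊢
    rw [ih, blockSum_lerchTerm_neg ha hq, h1]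
    push_cast
    rw [intPrimitive_add_one, add_sub_cancel_right]
    linear_combination (-(blockSum (lerchTerm a q 0) n (N + 1) - lerchTerm a q 0 (n * (N + 1)) +
      lerchTerm a q 0 (n * N)) * (intPrimitive (lerchTerm b p 0) N - Z)) * hs

/-! ### Summation along the lines m - n l = i. -/

theorem lerchTerm_mul_lerchTerm_mul_add {a b : ℝ} (ha : a ≠ 0) (p q n : ℕ) (l i : ℤ) :
    lerchTerm b p 0 l * lerchTerm a q 0 (n * l + i) =
      a ^ i * ((a ^ n * b) ^ l * (regPow p l * regPow q (n * l + i))) := by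
  rw [lerchTerm, lerchTerm, zpow_add₀ ha, zpow_mul, zpow_natCast, mul_zpow]
  push_cast
  rw [add_zero, add_zero]
  ring

/-- On the diagonal m = n l the two powers merge into a single Lerch series of order p + q. -/
theorem tendsto_sum_lerchTerm_mul_lerchTerm_mul {a b : ℝ} {p q n : ℕ}
    (ha : a = 1 ∨ a = -1) (hc : a ^ n * b = 1 ∨ a ^ n * b = -1) (hp : p ≠ 0) (hq : q ≠ 0)
    (hn : n ≠ 0) :
    Tendsto (fun N : ℕ => ∑ k ∈ range N, lerchTerm b p 0 (k + 1) * lerchTerm a q 0 (n * (k + 1)))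
      atTop (𝓝 ((n : ℝ)⁻¹ ^ q * (a ^ n * b * lerchPhi (a ^ n * b) (p + q) 1))) := by
  have hpq : p + q ≠ 0 := by omega
  have h := (tendsto_sum_lerchTerm_add_one hc (k := p + q) hpq (by rintro ⟨-, h⟩; omega) (x := 0)
    (by norm_num)).const_mul ((n : ℝ)⁻¹ ^ q)
  rw [add_zero] at h
  refine h.congr fun N => ?_
  rw [mul_sum]
  refine sum_congr rfl fun k _ => ?_
  have h2 := lerchTerm_mul_lerchTerm_mul_add (b := b) (sign_ne_zero_real ha) p q n
    ((k : ℤ) + 1) 0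
  rw [add_zero] at h2
  rw [h2, lerchTerm, Int.cast_zero, add_zero, add_zero, regPow_mul (by exact_mod_cast hn),
    regPow_of_ne_zero hp, regPow_of_ne_zero hq, regPow_of_ne_zero hpq, pow_add, zpow_zero]
  ring

theorem mul_regPow_mul_regPow_eq {c : ℝ} (hc : c = 1 ∨ c = -1) {p q n t : ℕ} (hp : 1 ≤ p)
    (hq : 1 ≤ q) (ht : t < n) (r : ℕ) (l : ℤ) :
    c ^ l * (regPow p l * regPow q (n * l + (n * (r + 1 : ℕ) - t : ℤ))) =
      (-n : ℝ) ^ p * (∑ k ∈ range (p + 1), ((p + q - k - 1).choose (q - 1) : ℝ) *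
          (n * (r + 1 : ℕ) - t : ℝ)⁻¹ ^ (p + q - k) * (-n : ℝ)⁻¹ ^ k * lerchTerm c k 0 l +
        ∑ k ∈ range (q + 1), ((p + q - k - 1).choose (p - 1) : ℝ) *
          (n * (r + 1 : ℕ) - t : ℝ)⁻¹ ^ (p + q - k) * (n : ℝ)⁻¹ ^ k * c ^ (r + 1) *
            lerchTerm c k (-(t / n : ℝ)) (l + (r + 1 : ℕ))) := by
  have hn : (n : ℝ) ≠ 0 := by
    have : n ≠ 0 := by omega
    exact_mod_cast this
  have hn' : (-n : ℝ) ≠ 0 := neg_ne_zero.2 hn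
  have hi : (n * (r + 1 : ℕ) - t : ℝ) ≠ 0 := by
    have h1 : (t : ℝ) < n := by exact_mod_cast ht
    have h2 : (n : ℝ) * 1 ≤ n * (r + 1 : ℕ) := by
      gcongr
      push_cast
      linarith [(Nat.cast_nonneg r : (0 : ℝ) ≤ r)]
    linarith
  -- Here X = -n l and Y = m, and their sum i = n(r+1) - t is positive because t < n.
  have hpf := regPow_mul_regPow (X := -n * l) (Y := n * l + (n * (r + 1 : ℕ) - t : ℝ))
    (i := (n * (r + 1 : ℕ) - t : ℝ)) (by ring) hi hp hq
  have hX : regPow p l = (-n : ℝ) ^ p * regPow p (-n * l) := by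
    rw [regPow_mul hn', inv_pow, mul_inv_cancel_left₀ (pow_ne_zero _ hn')]
  have hcast : ((n * (r + 1 : ℕ) - t : ℤ) : ℝ) = n * (r + 1 : ℕ) - t := by push_cast; ring
  rw [hcast, hX, mul_assoc, hpf, mul_left_comm, mul_add, mul_sum, mul_sum]
  congr 2
  · refine sum_congr rfl fun k _ => ?_
    rw [regPow_mul hn', lerchTerm, add_zero]
    ring
  · refine sum_congr rfl fun k _ => ?_
    have hY : n * (l : ℝ) + (n * (r + 1 : ℕ) - t : ℝ) =
        n * (((l + (r + 1 : ℕ) : ℤ) : ℝ) + -(t / n : ℝ)) := by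
      push_cast
      field_simp
      ring
    have hcc : c ^ (r + 1) * c ^ (r + 1) = 1 := by
      rw [← mul_pow, sign_mul_sign hc, one_pow]
    rw [hY, regPow_mul hn, lerchTerm, zpow_add₀ (sign_ne_zero_real hc), zpow_natCast]
    linear_combination (-((p + q - k - 1).choose (p - 1) : ℝ) *
      (n * (r + 1 : ℕ) - t : ℝ)⁻¹ ^ (p + q - k) * (n : ℝ)⁻¹ ^ k * c ^ l *
      regPow k (((l + (r + 1 : ℕ) : ℤ) : ℝ) + -(t / n : ℝ))) * hcc

section LineSum

variable {a b : ℝ} {p q n : ℕ} {E : ℕ → ℝ} {Y : ℕ → ℕ → ℝ}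

/-- The sum over a line `x - l = const` in terms of the limits `E` and `Y` of two-sided Lerch
series. -/
theorem tsum_lerchTerm_mul_blockSum (ha : a = 1 ∨ a = -1) (hc : a ^ n * b = 1 ∨ a ^ n * b = -1)
    (hp : 1 ≤ p) (hq : 1 ≤ q)
    (hE : ∀ k, Tendsto (balancedSum (lerchTerm (a ^ n * b) k 0)) atTop (𝓝 (E k)))
    (hY : ∀ t < n, ∀ k, Tendsto (balancedSum (lerchTerm (a ^ n * b) k (-(t / n : ℝ)))) atTop
      (𝓝 (Y t k)))
    (r : ℕ)
    (hs : Summable fun l => lerchTerm b p 0 l * blockSum (lerchTerm a q 0) n (l + (r + 1 : ℕ))) :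
    ∑' l, lerchTerm b p 0 l * blockSum (lerchTerm a q 0) n (l + (r + 1 : ℕ)) =
      (-n : ℝ) ^ p * ∑ t ∈ range n, a ^ (n * (r + 1 : ℕ) - t : ℤ) *
        (∑ k ∈ range (p + 1), ((p + q - k - 1).choose (q - 1) : ℝ) *
          (n * (r + 1 : ℕ) - t : ℝ)⁻¹ ^ (p + q - k) * (-n : ℝ)⁻¹ ^ k * E k +
        ∑ k ∈ range (q + 1), ((p + q - k - 1).choose (p - 1) : ℝ) *
          (n * (r + 1 : ℕ) - t : ℝ)⁻¹ ^ (p + q - k) * (n : ℝ)⁻¹ ^ k * (a ^ n * b) ^ (r + 1) *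
            Y t k) := by
  -- The separate partial fractions need not be summable, so the line sum is computed as a limit of
  -- balanced sums.
  refine tendsto_nhds_unique (tendsto_balancedSum_tsum hs) ?_
  have hterm : (fun l => lerchTerm b p 0 l * blockSum (lerchTerm a q 0) n (l + (r + 1 : ℕ))) =
      fun l => ∑ t ∈ range n, ((-n : ℝ) ^ p * a ^ (n * (r + 1 : ℕ) - t : ℤ)) *
        (∑ k ∈ range (p + 1), ((p + q - k - 1).choose (q - 1) : ℝ) *
          (n * (r + 1 : ℕ) - t : ℝ)⁻¹ ^ (p + q - k) * (-n : ℝ)⁻¹ ^ k *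
            lerchTerm (a ^ n * b) k 0 l +
        ∑ k ∈ range (q + 1), ((p + q - k - 1).choose (p - 1) : ℝ) *
          (n * (r + 1 : ℕ) - t : ℝ)⁻¹ ^ (p + q - k) * (n : ℝ)⁻¹ ^ k * (a ^ n * b) ^ (r + 1) *
            lerchTerm (a ^ n * b) k (-(t / n : ℝ)) (l + (r + 1 : ℕ))) := by
    funext l
    rw [blockSum, mul_sum]
    refine sum_congr rfl fun t ht => ?_
    rw [show (n : ℤ) * (l + (r + 1 : ℕ)) - t = n * l + (n * (r + 1 : ℕ) - t) by ring,
      lerchTerm_mul_lerchTerm_mul_add (sign_ne_zero_real ha),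
      mul_regPow_mul_regPow_eq hc hp hq (mem_range.1 ht)]
    ring
  rw [hterm]
  rw [mul_sum]
  refine Tendsto.congr (fun N => (balancedSum_finset_sum _ _ N).symm) ?_
  refine tendsto_finsetSum _ fun t ht => ?_
  refine Tendsto.congr (fun N => (balancedSum_mul_left _ _ N).symm) ?_
  rw [← mul_assoc]
  refine Tendsto.const_mul _ ?_
  refine Tendsto.congr (fun N => (balancedSum_add _ _ N).symm) (Tendsto.add ?_ ?_)
  · refine Tendsto.congr (fun N => (balancedSum_finset_sum _ _ N).symm) ?_
    refine tendsto_finsetSum _ fun k _ => ?_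
    refine Tendsto.congr (fun N => (balancedSum_mul_left _ _ N).symm) ?_
    exact (hE k).const_mul _
  · refine Tendsto.congr (fun N => (balancedSum_finset_sum _ _ N).symm) ?_
    refine tendsto_finsetSum _ fun k _ => ?_
    refine Tendsto.congr (fun N => (balancedSum_mul_left _ _ N).symm) ?_
    exact (tendsto_balancedSum_shift (tendsto_lerchTerm_atTop hc _ _)
      (tendsto_lerchTerm_atBot hc _ _) (hY t (mem_range.1 ht) k) (r + 1)).const_mul _

/-- As r and t vary, i = n(r+1) - t runs once through the positive integers. The limits E do not
depend on t, so their coefficients sum over all i; the limits Y depend on t, so theirs sum over r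
for each t. -/
theorem tendsto_sum_tsum_lerchTerm_mul_blockSum (ha : a = 1 ∨ a = -1) (hb : b = 1 ∨ b = -1)
    (hc : a ^ n * b = 1 ∨ a ^ n * b = -1) (hp : 1 ≤ p) (hq : 1 ≤ q)
    (hbp : b = 1 → p ≠ 1) (haq : a = 1 → q ≠ 1) (hn : n ≠ 0)
    (hE : ∀ k, Tendsto (balancedSum (lerchTerm (a ^ n * b) k 0)) atTop (𝓝 (E k)))
    (hY : ∀ t < n, ∀ k, Tendsto (balancedSum (lerchTerm (a ^ n * b) k (-(t / n : ℝ)))) atTop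
      (𝓝 (Y t k)))
    (hs : ∀ r : ℤ, Summable fun l => lerchTerm b p 0 l * blockSum (lerchTerm a q 0) n (l + r)) :
    Tendsto (fun R : ℕ => ∑ r ∈ range R, ∑' l,
        lerchTerm b p 0 l * blockSum (lerchTerm a q 0) n (l + (r + 1 : ℕ))) atTop
      (𝓝 ((-n : ℝ) ^ p * (∑ k ∈ range (p + 1), ((p + q - k - 1).choose (q - 1) : ℝ) *
          (-n : ℝ)⁻¹ ^ k * E k * (a * lerchPhi a (p + q - k) 1) +
        ∑ t ∈ range n, ∑ k ∈ range (q + 1), ((p + q - k - 1).choose (p - 1) : ℝ) *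
          (n : ℝ)⁻¹ ^ k * Y t k * (a ^ t * (n : ℝ)⁻¹ ^ (p + q - k) *
            (b * lerchPhi b (p + q - k) (1 + -(t / n : ℝ))))))) := by
  have hn' : (n : ℝ) ≠ 0 := by exact_mod_cast hn
  have ha0 := sign_ne_zero_real ha
  have hN : Tendsto (fun R : ℕ => (n : ℤ) * R) atTop atTop :=
    tendsto_natCast_atTop_atTop.const_mul_atTop' (by omega)
  have hsum : ∀ R : ℕ, ∑ r ∈ range R, ∑' l,
      lerchTerm b p 0 l * blockSum (lerchTerm a q 0) n (l + (r + 1 : ℕ)) =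
      (-n : ℝ) ^ p * (∑ k ∈ range (p + 1), ((p + q - k - 1).choose (q - 1) : ℝ) *
          (-n : ℝ)⁻¹ ^ k * E k * intPrimitive (lerchTerm a (p + q - k) 0) (n * R) +
        ∑ t ∈ range n, ∑ k ∈ range (q + 1), ((p + q - k - 1).choose (p - 1) : ℝ) *
          (n : ℝ)⁻¹ ^ k * Y t k * (a ^ t * (n : ℝ)⁻¹ ^ (p + q - k) *
            ∑ r ∈ range R, lerchTerm b (p + q - k) (-(t / n : ℝ)) (r + 1))) := by
    intro R
    have h1 : ∑ r ∈ range R, ∑' l,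
        lerchTerm b p 0 l * blockSum (lerchTerm a q 0) n (l + (r + 1 : ℕ)) =
        (-n : ℝ) ^ p * (∑ r ∈ range R, ∑ t ∈ range n, ∑ k ∈ range (p + 1),
          ((p + q - k - 1).choose (q - 1) : ℝ) * (-n : ℝ)⁻¹ ^ k * E k *
            lerchTerm a (p + q - k) 0 (n * (r + 1) - t) +
          ∑ r ∈ range R, ∑ t ∈ range n, ∑ k ∈ range (q + 1),
          ((p + q - k - 1).choose (p - 1) : ℝ) * (n : ℝ)⁻¹ ^ k * Y t k *
            (a ^ t * (n : ℝ)⁻¹ ^ (p + q - k) *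
              lerchTerm b (p + q - k) (-(t / n : ℝ)) (r + 1))) := by
      rw [← sum_add_distrib, mul_sum]
      refine sum_congr rfl fun r _ => ?_
      rw [tsum_lerchTerm_mul_blockSum ha hc hp hq hE hY r (hs _), ← sum_add_distrib]
      congr 1
      refine sum_congr rfl fun t ht => ?_
      rw [mul_add, mul_sum, mul_sum]
      congr 1
      · refine sum_congr rfl fun k hk => ?_
        have := mem_range.1 hk
        rw [lerchTerm, regPow_of_ne_zero (by omega)]
        push_cast
        rw [add_zero]
        ring
      · refine sum_congr rfl fun k hk => ?_
        have := mem_range.1 hk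
        have hcast : ((r : ℤ) + 1 : ℤ) = ((r + 1 : ℕ) : ℤ) := by push_cast; rfl
        -- The two factors a^{n(r+1)} cancel because a² = 1, leaving a series of sign b.
        have hab : a ^ (n * (r + 1 : ℕ) - t : ℤ) * (a ^ n * b) ^ (r + 1) = a ^ t * b ^ (r + 1) := by
          have h2 : a ^ (n * (r + 1 : ℕ) - t : ℤ) = a ^ (n * (r + 1)) * a ^ t := by
            rw [sub_eq_add_neg, zpow_add₀ ha0, sign_zpow_neg ha, zpow_natCast, ← Nat.cast_mul,
              zpow_natCast]
          have h3 : a ^ (n * (r + 1)) * a ^ (n * (r + 1)) = 1 := by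
            rw [← mul_pow, sign_mul_sign ha, one_pow]
          rw [h2, mul_pow, ← pow_mul]
          linear_combination (a ^ t * b ^ (r + 1)) * h3
        have hinv : (n * (r + 1 : ℕ) - t : ℝ)⁻¹ =
            (n : ℝ)⁻¹ * (((r + 1 : ℕ) : ℝ) + -(t / n : ℝ))⁻¹ := by
          rw [← mul_inv, mul_add, mul_neg, mul_div_cancel₀ _ hn', sub_eq_add_neg]
        rw [lerchTerm, regPow_of_ne_zero (by omega), hcast, zpow_natCast, Int.cast_natCast, hinv,
          mul_pow]
        linear_combination (((p + q - k - 1).choose (p - 1) : ℝ) * (n : ℝ)⁻¹ ^ k * Y t k *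
          (n : ℝ)⁻¹ ^ (p + q - k) *
          (((r + 1 : ℕ) : ℝ) + -(t / n : ℝ))⁻¹ ^ (p + q - k)) * hab
    rw [h1]
    congr 2
    · simp only [← sum_blockSum_eq_intPrimitive, blockSum, mul_sum]
      refine Eq.trans ?_ sum_comm
      exact sum_congr rfl fun r _ => sum_comm
    · rw [sum_comm]
      refine sum_congr rfl fun t _ => ?_
      rw [sum_comm]
      refine sum_congr rfl fun k _ => ?_
      rw [mul_sum, mul_sum]
  refine Tendsto.congr (fun R => (hsum R).symm) (Tendsto.const_mul _ (Tendsto.add ?_ ?_))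
  · refine tendsto_finsetSum _ fun k hk => ?_
    have := mem_range.1 hk
    refine Tendsto.const_mul _ ((tendsto_intPrimitive_lerchTerm_atTop ha (by omega) ?_).comp hN)
    -- Since k ≤ p, order p + q - k = 1 would force q = 1, excluded for a = 1.
    rintro ⟨h1, h2⟩
    have := haq h1
    omega
  · refine tendsto_finsetSum _ fun t ht => tendsto_finsetSum _ fun k hk => ?_
    have := mem_range.1 hk
    have ht' : (t / n : ℝ) < 1 := by
      rw [div_lt_one (by positivity)]
      exact_mod_cast mem_range.1 ht
    refine Tendsto.const_mul _ (Tendsto.const_mul _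
      (tendsto_sum_lerchTerm_add_one hb (by omega) ?_ (by linarith)))
    rintro ⟨h1, h2⟩
    have := hbp h1
    omega

end LineSum

/-! ### Evaluation of the limits and assembly. -/

theorem sum_Icc_one_eq_sum_range (f : ℕ → ℝ) (n : ℕ) :
    ∑ j ∈ Icc 1 n, f j = ∑ t ∈ range n, f (t + 1) := by
  induction n with
  | zero => simp
  | succ n ih => rw [sum_Icc_succ_top (by omega), sum_range_succ, ih]

theorem sum_range_ite_even (f : ℕ → ℝ) (p : ℕ) :
    ∑ k ∈ range (p + 1), (if Even k then f k else 0) = ∑ j ∈ Icc 0 (p / 2), f (2 * j) := by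
  rw [← sum_filter]
  refine (sum_nbij' (fun j => 2 * j) (fun k => k / 2) ?_ ?_ ?_ ?_ ?_).symm
  · intro j hj
    have := mem_Icc.1 hj
    exact mem_filter.2 ⟨mem_range.2 (by omega), even_two_mul j⟩
  · intro k hk
    have := mem_range.1 (mem_filter.1 hk).1
    exact mem_Icc.2 ⟨by omega, by omega⟩
  · intro j _
    exact Nat.mul_div_cancel_left j two_pos
  · intro k hk
    exact Nat.two_mul_div_two_of_even (mem_filter.1 hk).2
  · intro j _
    rfl

theorem intPrimitive_lerchTerm_eq_genHarmonic (b : ℝ) {p : ℕ} (hp : p ≠ 0) (k : ℕ) :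
    intPrimitive (lerchTerm b p 0) k = b * genHarmonic p b k := by
  rw [intPrimitive_natCast, genHarmonic, sum_Icc_one_eq_sum_range, mul_sum]
  refine sum_congr rfl fun m _ => ?_
  rw [lerchTerm_natCast_add_one hp, Nat.add_sub_cancel]
  push_cast
  rw [add_zero]

theorem blockSum_lerchTerm_eq {a : ℝ} {q : ℕ} (hq : q ≠ 0) (n k : ℕ) :
    blockSum (lerchTerm a q 0) n (k + 1) =
      a * ((a ^ n) ^ k * ∑ j ∈ Icc 1 n, a ^ (j - 1) / ((n : ℝ) * k + j) ^ q) := by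
  rw [blockSum, ← sum_range_reflect, sum_Icc_one_eq_sum_range, mul_sum, mul_sum]
  refine sum_congr rfl fun t ht => ?_
  have := mem_range.1 ht
  have h : (n : ℤ) * (k + 1) - (n - 1 - t : ℕ) = ((n * k + t : ℕ) : ℤ) + 1 := by
    have h2 : ((n - 1 - t : ℕ) : ℤ) = n - 1 - t := by omega
    rw [h2]
    push_cast
    ring
  rw [h, lerchTerm_natCast_add_one hq, Nat.add_sub_cancel, pow_add, pow_mul]
  push_cast
  ring

/-- The limit of the balanced partial sums of `lerchTerm c k (-(t / n))`. -/
noncomputable def lerchTermLimit (c : ℝ) (n t k : ℕ) : ℝ :=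
  if t = 0 then (if Even k then 2 * c * lerchPhi c k 1 else 0)
  else if k = 0 then 0 else (-1) ^ k * lerchTheta c k t n

theorem tendsto_balancedSum_lerchTermLimit {c : ℝ} (hc : c = 1 ∨ c = -1) {n t : ℕ} (ht : t < n)
    (k : ℕ) : Tendsto (balancedSum (lerchTerm c k (-(t / n : ℝ)))) atTop
      (𝓝 (lerchTermLimit c n t k)) := by
  rw [lerchTermLimit]
  split_ifs with h0 hev hk
  · have h := tendsto_balancedSum_lerchTerm_zero hc k
    rw [if_pos hev] at h
    simpa [h0] using h
  · have h := tendsto_balancedSum_lerchTerm_zero hc k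
    rw [if_neg hev] at h
    simpa [h0] using h
  -- For 0 < t < n no integer l equals t/n, so the order-0 indicator never fires.
  · have hzero : lerchTerm c k (-(t / n : ℝ)) = fun _ => 0 := by
      funext l
      have hn : (n : ℝ) ≠ 0 := by
        have : n ≠ 0 := by omega
        exact_mod_cast this
      have hl : (l : ℝ) + -(t / n) ≠ 0 := by
        intro h
        have h1 : (l : ℝ) * n = t := by
          field_simp at h
          linarith
        have h2 : l * n = t := by exact_mod_cast h1
        have h3 : (n : ℤ) ∣ t := ⟨l, by rw [← h2, mul_comm]⟩
        exact h0 (Nat.eq_zero_of_dvd_of_lt (Int.natCast_dvd_natCast.1 h3) ht)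
      rw [lerchTerm, hk, regPow_zero, if_neg hl, mul_zero]
    rw [hzero]
    have h0 : balancedSum (fun _ => 0) = fun _ => 0 := by
      funext N
      simp [balancedSum]
    rw [h0]
    exact tendsto_const_nhds
  · exact tendsto_balancedSum_lerchTerm_neg_div hc hk (Nat.pos_of_ne_zero h0) ht

theorem neg_natCast_zpow_neg (n q : ℕ) :
    (-(n : ℝ)) ^ (-(q : ℤ)) = (-1) ^ q * (n : ℝ)⁻¹ ^ q := by
  rw [zpow_neg, zpow_natCast, ← inv_pow, inv_neg, neg_pow]

theorem pow_mul_inv_pow_mul_inv_pow {x : ℝ} (hx : x ≠ 0) {p q k : ℕ} (hk : k ≤ p + q) :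
    x ^ p * (x⁻¹ ^ k * x⁻¹ ^ (p + q - k)) = x⁻¹ ^ q := by
  rw [← pow_add, Nat.add_sub_cancel' hk, pow_add, ← mul_assoc, ← mul_pow, mul_inv_cancel₀ hx,
    one_pow, one_mul]

section Evaluation

variable {a b : ℝ} {p q n : ℕ}

/-- The contribution of the poles l = 0: only even orders survive, and the signs combine by a² = b²
= 1. -/
theorem sum_range_lerchTermLimit_zero_left (ha : a = 1 ∨ a = -1) (hb : b = 1 ∨ b = -1) :
    1 / 2 * (a * b) * ((-n : ℝ) ^ p * ∑ k ∈ range (p + 1), ((p + q - k - 1).choose (q - 1) : ℝ) *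
      (-n : ℝ)⁻¹ ^ k * lerchTermLimit (a ^ n * b) n 0 k * (a * lerchPhi a (p + q - k) 1)) =
    a ^ n * (-(n : ℝ)) ^ p *
      ∑ k ∈ Icc 0 (p / 2), ((p + q - 2 * k - 1).choose (q - 1) : ℝ) *
        (n : ℝ) ^ (-(2 * k : ℤ)) *
        lerchPhi (a ^ n * b) (2 * k) 1 * lerchPhi a (p + q - 2 * k) 1 := by
  have h : ∀ k, ((p + q - k - 1).choose (q - 1) : ℝ) *
      (-n : ℝ)⁻¹ ^ k * lerchTermLimit (a ^ n * b) n 0 k * (a * lerchPhi a (p + q - k) 1) =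
      if Even k then ((p + q - k - 1).choose (q - 1) : ℝ) * (-n : ℝ)⁻¹ ^ k *
        (2 * (a ^ n * b) * lerchPhi (a ^ n * b) k 1) * (a * lerchPhi a (p + q - k) 1) else 0 := by
    intro k
    rw [lerchTermLimit, if_pos rfl]
    split_ifs <;> ring
  simp only [h]
  rw [sum_range_ite_even (fun k => ((p + q - k - 1).choose (q - 1) : ℝ) * (-n : ℝ)⁻¹ ^ k *
    (2 * (a ^ n * b) * lerchPhi (a ^ n * b) k 1) * (a * lerchPhi a (p + q - k) 1))]
  simp only [mul_sum]
  refine sum_congr rfl fun k _ => ?_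
  have h1 : (n : ℝ) ^ (-(2 * k : ℤ)) = (-n : ℝ)⁻¹ ^ (2 * k) := by
    rw [inv_neg, (even_two_mul k).neg_pow, zpow_neg, inv_pow]
    norm_cast
  rw [h1]
  have haa := sign_mul_sign ha
  have hbb := sign_mul_sign hb
  linear_combination (a ^ n * (-(n : ℝ)) ^ p * ((p + q - 2 * k - 1).choose (q - 1) : ℝ) *
    (-n : ℝ)⁻¹ ^ (2 * k) * lerchPhi (a ^ n * b) (2 * k) 1 * lerchPhi a (p + q - 2 * k) 1) *
      (b * b * haa + hbb)

/-- The contribution of the poles m = 0 on the lines with t = 0. The powers of n combine to n^{-q},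
and (-1)^p = -(-1)^q turns the sign. -/
theorem sum_range_lerchTermLimit_zero_right (ha : a = 1 ∨ a = -1) (hb : b = 1 ∨ b = -1)
    (hpq : Odd (p + q)) (hn : 1 ≤ n) :
    1 / 2 * (a * b) * ((-n : ℝ) ^ p * ∑ k ∈ range (q + 1), ((p + q - k - 1).choose (p - 1) : ℝ) *
      (n : ℝ)⁻¹ ^ k * lerchTermLimit (a ^ n * b) n 0 k * ((n : ℝ)⁻¹ ^ (p + q - k) *
        (b * lerchPhi b (p + q - k) 1))) =
    -(a ^ (n - 1) * b * (-(n : ℝ)) ^ (-(q : ℤ)) *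
      ∑ j ∈ Icc 0 (q / 2), ((p + q - 2 * j - 1).choose (p - 1) : ℝ) *
        lerchPhi (a ^ n * b) (2 * j) 1 * lerchPhi b (p + q - 2 * j) 1) := by
  have hn0 : (n : ℝ) ≠ 0 := by
    have : n ≠ 0 := by omega
    exact_mod_cast this
  have h : ∀ k, ((p + q - k - 1).choose (p - 1) : ℝ) *
      (n : ℝ)⁻¹ ^ k * lerchTermLimit (a ^ n * b) n 0 k * ((n : ℝ)⁻¹ ^ (p + q - k) *
        (b * lerchPhi b (p + q - k) 1)) =
      if Even k then ((p + q - k - 1).choose (p - 1) : ℝ) *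
        (n : ℝ)⁻¹ ^ k * (2 * (a ^ n * b) * lerchPhi (a ^ n * b) k 1) * ((n : ℝ)⁻¹ ^ (p + q - k) *
        (b * lerchPhi b (p + q - k) 1)) else 0 := by
    intro k
    rw [lerchTermLimit, if_pos rfl]
    split_ifs <;> ring
  simp only [h]
  rw [sum_range_ite_even (fun k => ((p + q - k - 1).choose (p - 1) : ℝ) *
        (n : ℝ)⁻¹ ^ k * (2 * (a ^ n * b) * lerchPhi (a ^ n * b) k 1) * ((n : ℝ)⁻¹ ^ (p + q - k) *
        (b * lerchPhi b (p + q - k) 1)))]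
  simp only [mul_sum, ← sum_neg_distrib]
  refine sum_congr rfl fun k hk => ?_
  have := mem_Icc.1 hk
  have h1 := pow_mul_inv_pow_mul_inv_pow hn0 (p := p) (q := q) (k := 2 * k) (by omega)
  have haa := sign_mul_sign ha
  have hbb := sign_mul_sign hb
  have hs : ((-1 : ℝ)) ^ p = -(-1) ^ q := by
    have h2 : ((-1 : ℝ)) ^ p * (-1) ^ q = -1 := by rw [← pow_add, hpq.neg_one_pow]
    have h3 : ((-1 : ℝ)) ^ q * (-1) ^ q = 1 := by rw [← mul_pow]; norm_num
    linear_combination (-1) ^ q * h2 - (-1) ^ p * h3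
  obtain ⟨m, rfl⟩ := Nat.exists_eq_add_of_le' hn
  rw [neg_natCast_zpow_neg, ← h1, neg_pow, hs, Nat.add_sub_cancel, pow_succ a m]
  generalize (((m + 1 : ℕ) : ℝ)⁻¹ ^ (2 * k)) = x1
  generalize (((m + 1 : ℕ) : ℝ)⁻¹ ^ (p + q - 2 * k)) = x2
  generalize lerchPhi (a ^ m * a * b) (2 * k) 1 = y1
  linear_combination (-(-1) ^ q * ((m + 1 : ℕ) : ℝ) ^ p * x1 * x2 * y1 *
    ((p + q - 2 * k - 1).choose (p - 1) : ℝ) * a ^ m * b * lerchPhi b (p + q - 2 * k) 1) *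
      (b * b * haa + hbb)

/-- The contribution of the lines with t > 0, where the index j of the formula is the residue t plus
1. -/
theorem sum_range_lerchTermLimit_succ (ha : a = 1 ∨ a = -1) (hb : b = 1 ∨ b = -1)
    (hpq : Odd (p + q)) (hn : 1 ≤ n) :
    1 / 2 * (a * b) * ((-n : ℝ) ^ p * ∑ t ∈ range (n - 1), ∑ k ∈ range (q + 1),
      ((p + q - k - 1).choose (p - 1) : ℝ) *
      (n : ℝ)⁻¹ ^ k * lerchTermLimit (a ^ n * b) n (t + 1) k * (a ^ (t + 1) *
        (n : ℝ)⁻¹ ^ (p + q - k) * (b * lerchPhi b (p + q - k) (1 + -((t + 1 : ℕ) / n : ℝ))))) =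
    -(1 / 2 * (-(n : ℝ)) ^ (-(q : ℤ)) *
      ∑ j ∈ Icc 2 n, ∑ k ∈ Icc 1 q, ((p + q - k - 1).choose (p - 1) : ℝ) *
        a ^ j * (-1) ^ k * lerchTheta (a ^ n * b) k ((j : ℝ) - 1) n *
        lerchPhi b (p + q - k) (((n : ℝ) - j + 1) / n)) := by
  have hn0 : (n : ℝ) ≠ 0 := by
    have : n ≠ 0 := by omega
    exact_mod_cast this
  have hIcc : ∀ f : ℕ → ℝ, ∑ j ∈ Icc 2 n, f j = ∑ t ∈ range (n - 1), f (t + 2) := by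
    intro f
    rw [← Ico_add_one_right_eq_Icc, sum_Ico_eq_sum_range]
    refine sum_congr (by congr 1) fun t _ => by rw [add_comm]
  rw [hIcc]
  simp only [mul_sum, ← sum_neg_distrib]
  refine sum_congr rfl fun t _ => ?_
  rw [sum_range_succ', sum_Icc_one_eq_sum_range]
  have hzero : lerchTermLimit (a ^ n * b) n (t + 1) 0 = 0 := by simp [lerchTermLimit]
  rw [hzero, mul_zero, zero_mul, mul_zero, mul_zero, add_zero]
  refine sum_congr rfl fun k hk => ?_
  have := mem_range.1 hk
  have h1 := pow_mul_inv_pow_mul_inv_pow hn0 (p := p) (q := q) (k := k + 1) (by omega)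
  have haa := sign_mul_sign ha
  have hbb := sign_mul_sign hb
  have hs : ((-1 : ℝ)) ^ p = -(-1) ^ q := by
    have h2 : ((-1 : ℝ)) ^ p * (-1) ^ q = -1 := by rw [← pow_add, hpq.neg_one_pow]
    have h3 : ((-1 : ℝ)) ^ q * (-1) ^ q = 1 := by rw [← mul_pow]; norm_num
    linear_combination (-1) ^ q * h2 - (-1) ^ p * h3
  have harg : ((n : ℝ) - (t + 2 : ℕ) + 1) / n = 1 + -((t + 1 : ℕ) / n : ℝ) := by
    push_cast
    field_simp
    ring
  have harg2 : ((t + 2 : ℕ) : ℝ) - 1 = (t + 1 : ℕ) := by push_cast; ring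
  rw [neg_natCast_zpow_neg, ← h1, neg_pow, hs, harg, harg2, lerchTermLimit,
    if_neg (Nat.succ_ne_zero t), if_neg (Nat.succ_ne_zero k), show t + 2 = t + 1 + 1 by rfl,
    pow_succ a (t + 1)]
  generalize lerchPhi b (p + q - (k + 1)) (1 + -((t + 1 : ℕ) / n : ℝ)) = y1
  generalize lerchTheta (a ^ n * b) (k + 1) (t + 1 : ℕ) n = y2
  linear_combination (-1 / 2 * (-1) ^ q * (n : ℝ) ^ p * (n : ℝ)⁻¹ ^ (k + 1) *
    (n : ℝ)⁻¹ ^ (p + q - (k + 1)) * y1 * y2 * (-1) ^ (k + 1) *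
    ((p + q - (k + 1) - 1).choose (p - 1) : ℝ) * a ^ (t + 1) * a) * hbb

/-- The double series as half of the lattice sum, up to products and the diagonal. -/
theorem tendsto_sum_genHarmonic_mul (hp : 1 ≤ p) (hq : 1 ≤ q) (hn : 1 ≤ n)
    (hpq : Odd (p + q)) (ha : a = 1 ∨ a = -1) (hb : b = 1 ∨ b = -1)
    (hbp : b = 1 → p ≠ 1) (haq : a = 1 → q ≠ 1) :
    Tendsto
      (fun N : ℕ => ∑ k ∈ Icc 1 N, (a ^ n) ^ k * genHarmonic p b k *
        ∑ j ∈ Icc 1 n, a ^ (j - 1) / ((n : ℝ) * k + j) ^ q)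
      atTop
      (𝓝 (a * b * (1 / 2 * ((-n : ℝ) ^ p *
          (∑ k ∈ range (p + 1), ((p + q - k - 1).choose (q - 1) : ℝ) *
            (-n : ℝ)⁻¹ ^ k * lerchTermLimit (a ^ n * b) n 0 k * (a * lerchPhi a (p + q - k) 1) +
          ∑ t ∈ range n, ∑ k ∈ range (q + 1), ((p + q - k - 1).choose (p - 1) : ℝ) *
            (n : ℝ)⁻¹ ^ k * lerchTermLimit (a ^ n * b) n t k *
            (a ^ t * (n : ℝ)⁻¹ ^ (p + q - k) *
              (b * lerchPhi b (p + q - k) (1 + -(t / n : ℝ))))) -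
        ((-1) ^ p - 1) * (b * lerchPhi b p 1) * (a * lerchPhi a q 1) -
        (n : ℝ)⁻¹ ^ q * (a ^ n * b * lerchPhi (a ^ n * b) (p + q) 1))))) := by
  have hp0 : p ≠ 0 := by omega
  have hq0 : q ≠ 0 := by omega
  have hn0 : n ≠ 0 := by omega
  have haa := sign_mul_sign ha
  have hbb := sign_mul_sign hb
  have hc : a ^ n * b = 1 ∨ a ^ n * b = -1 := by
    rw [← mul_self_eq_one_iff, mul_mul_mul_comm, ← mul_pow, haa, hbb, one_pow, one_mul]
  have hap : ¬(a = 1 ∧ q = 1) := fun h => haq h.1 h.2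
  have hbp' : ¬(b = 1 ∧ p = 1) := fun h => hbp h.1 h.2
  have hNtop : Tendsto (fun x : ℤ => (n : ℤ) * x) atTop atTop :=
    tendsto_id.const_mul_atTop' (by omega)
  have hNbot : Tendsto (fun x : ℤ => (n : ℤ) * x) atBot atBot :=
    by simpa [Function.comp_def] using
      tendsto_neg_atTop_atBot.comp (hNtop.comp tendsto_neg_atBot_atTop)
  have hNnat : Tendsto (fun N : ℕ => (n : ℤ) * N) atTop atTop :=
    hNtop.comp tendsto_natCast_atTop_atTop
  have hVt := tendsto_intPrimitive_lerchTerm_atTop ha hq0 hap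
  have hVb := tendsto_intPrimitive_lerchTerm_atBot ha hq0 hap
  have hUt := tendsto_intPrimitive_lerchTerm_atTop hb hp0 hbp'
  have hUb := tendsto_intPrimitive_lerchTerm_atBot hb hp0 hbp'
  -- For p = 1 the parity makes q even, hence q ≥ 2.
  have hsum : Summable (lerchTerm b p 0) ∨ Summable (blockSum (lerchTerm a q 0) n) := by
    by_cases hp1 : p = 1
    · refine Or.inr (summable_blockSum (summable_lerchTerm ha ?_) hn0)
      obtain ⟨m, hm⟩ := hpq
      omega
    · exact Or.inl (summable_lerchTerm hb (by omega))
  obtain ⟨hs, σ, hT, hF⟩ := exists_tendsto_lattice_sum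
    (W := fun x => intPrimitive (lerchTerm a q 0) (n * x)) (intPrimitive_add_one _)
    (intPrimitive_mul_add_one _ n) hUt hUb (hVt.comp hNtop) (hVb.comp hNbot) hsum
  have hσ := tendsto_nhds_unique hT (tendsto_sum_tsum_lerchTerm_mul_blockSum ha hb hc hp hq hbp haq
    hn0 (fun k => by simpa using tendsto_balancedSum_lerchTermLimit hc hn k)
    (fun t ht k => tendsto_balancedSum_lerchTermLimit hc ht k) hs)
  have hD := tendsto_sum_lerchTerm_mul_lerchTerm_mul ha hc hp0 hq0 hn0
  have hV := (hVt.comp hNnat).const_mul (((-1) ^ p - 1) * (b * lerchPhi b p 1))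
  have hv0 := ((tendsto_lerchTerm_atTop ha q 0).comp hNnat).mul
    ((tendsto_int_atTop_iff.1 hUt).sub_const (b * lerchPhi b p 1))
  have hS : Tendsto (fun N : ℕ => ∑ k ∈ range N, blockSum (lerchTerm a q 0) n (k + 1) *
      intPrimitive (lerchTerm b p 0) k) atTop (𝓝 (1 / 2 * (σ -
        ((-1) ^ p - 1) * (b * lerchPhi b p 1) * (a * lerchPhi a q 1) -
        (n : ℝ)⁻¹ ^ q * (a ^ n * b * lerchPhi (a ^ n * b) (p + q) 1)))) := by
    have h := ((((hF.sub hV).add hv0).sub hD)).const_mul (1 / 2)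
    rw [zero_mul, add_zero] at h
    refine h.congr fun N => ?_
    rw [balancedSum_blockSum_mul_eq ha hb hp0 hq0 hpq]
    simp only [Function.comp_apply]
    ring
  -- The shift by one absorbs the term k = 0, which vanishes because the primitive is 0 there.
  have hfin := ((tendsto_add_atTop_iff_nat 1).2 hS).const_mul (a * b)
  rw [← hσ]
  refine hfin.congr fun N => ?_
  rw [sum_range_succ', sum_Icc_one_eq_sum_range]
  have h0 : intPrimitive (lerchTerm b p 0) ((0 : ℕ) : ℤ) = 0 := by
    rw [intPrimitive_natCast, sum_range_zero]
  rw [h0, mul_zero, add_zero, mul_sum]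
  refine sum_congr rfl fun k _ => ?_
  rw [blockSum_lerchTerm_eq hq0, intPrimitive_lerchTerm_eq_genHarmonic b hp0]
  generalize ∑ j ∈ Icc 1 n, a ^ (j - 1) / ((n : ℝ) * (k + 1 : ℕ) + j) ^ q = y
  linear_combination ((a ^ n) ^ (k + 1) * genHarmonic p b (k + 1) * y) * (b * b * haa + hbb)

end Evaluation

theorem theorem7 (p q n : ℕ) (hp : 1 ≤ p) (hq : 1 ≤ q) (hn : 1 ≤ n) (hpq : Odd (p + q))
    (a b : ℝ) (ha : a = 1 ∨ a = -1) (hb : b = 1 ∨ b = -1)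
    (hbp : b = 1 → p ≠ 1) (haq : a = 1 → q ≠ 1) :
    Tendsto
      (fun N : ℕ => ∑ k ∈ Icc 1 N, (a ^ n) ^ k * genHarmonic p b k *
        ∑ j ∈ Icc 1 n, a ^ (j - 1) / ((n : ℝ) * k + j) ^ q)
      atTop
      (𝓝 (-(1 / 2) * a ^ (n - 1) * (n : ℝ) ^ (-(q : ℤ)) * lerchPhi (a ^ n * b) (p + q) 1
        + 1 / 2 * (1 + (-1) ^ q) * lerchPhi a q 1 * lerchPhi b p 1
        - a ^ (n - 1) * b * (-(n : ℝ)) ^ (-(q : ℤ)) *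
            ∑ j ∈ Icc 0 (q / 2), ((p + q - 2 * j - 1).choose (p - 1) : ℝ) *
              lerchPhi (a ^ n * b) (2 * j) 1 * lerchPhi b (p + q - 2 * j) 1
        + a ^ n * (-(n : ℝ)) ^ p *
            ∑ k ∈ Icc 0 (p / 2), ((p + q - 2 * k - 1).choose (q - 1) : ℝ) *
              (n : ℝ) ^ (-(2 * k : ℤ)) *
              lerchPhi (a ^ n * b) (2 * k) 1 * lerchPhi a (p + q - 2 * k) 1
        - 1 / 2 * (-(n : ℝ)) ^ (-(q : ℤ)) *
            ∑ j ∈ Icc 2 n, ∑ k ∈ Icc 1 q, ((p + q - k - 1).choose (p - 1) : ℝ) *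
              a ^ j * (-1) ^ k * lerchTheta (a ^ n * b) k ((j : ℝ) - 1) n *
              lerchPhi b (p + q - k) (((n : ℝ) - j + 1) / n))) := by
  have haa := sign_mul_sign ha
  have hbb := sign_mul_sign hb
  have hA := sum_range_lerchTermLimit_zero_left (p := p) (q := q) (n := n) ha hb
  have hB := sum_range_lerchTermLimit_zero_right ha hb hpq hn
  have hC := sum_range_lerchTermLimit_succ ha hb hpq hn
  have hs : ((-1 : ℝ)) ^ q = -(-1) ^ p := by
    have h2 : ((-1 : ℝ)) ^ p * (-1) ^ q = -1 := by rw [← pow_add, hpq.neg_one_pow]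
    have h3 : ((-1 : ℝ)) ^ p * (-1) ^ p = 1 := by rw [← mul_pow]; norm_num
    linear_combination (-1) ^ p * h2 - (-1) ^ q * h3
  have hz : (n : ℝ) ^ (-(q : ℤ)) = (n : ℝ)⁻¹ ^ q := by rw [zpow_neg, zpow_natCast, inv_pow]
  have han : a ^ n = a ^ (n - 1) * a := by rw [← pow_succ, Nat.sub_add_cancel hn]
  have hsplit : ∀ f : ℕ → ℝ, ∑ t ∈ range n, f t = ∑ t ∈ range (n - 1), f (t + 1) + f 0 := by
    intro f
    rw [← sum_range_succ', Nat.sub_add_cancel hn]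
  -- A, B, C stand for the pole l = 0, the residue t = 0 and the residues t > 0; only signs remain
  -- to be matched.
  have halg : ∀ x y F A B C A' B' C' : ℝ, 1 / 2 * (a * b) * (x * A) = A' →
      1 / 2 * (a * b) * (x * B) = -B' → 1 / 2 * (a * b) * (x * C) = -C' →
      -(1 / 2) * a ^ (n - 1) * y * F + 1 / 2 * (1 + -(-1) ^ p) * lerchPhi a q 1 * lerchPhi b p 1
        - B' + A' - C' =
      a * b * (1 / 2 * (x * (A + (C + B)) - ((-1) ^ p - 1) * (b * lerchPhi b p 1) *
        (a * lerchPhi a q 1) - y * (a ^ (n - 1) * a * b * F))) := by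
    intro x y F A B C A' B' C' h1 h2 h3
    linear_combination -h1 - h2 - h3 + (1 / 2 * a ^ (n - 1) * y * F +
      1 / 2 * ((-1) ^ p - 1) * lerchPhi a q 1 * lerchPhi b p 1) * (b * b * haa + hbb)
  have key := tendsto_sum_genHarmonic_mul hp hq hn hpq ha hb hbp haq
  rw [hsplit] at key
  simp only [Nat.cast_zero, zero_div, neg_zero, add_zero, pow_zero, one_mul] at key
  have h := halg _ ((n : ℝ)⁻¹ ^ q) (lerchPhi (a ^ n * b) (p + q) 1) _ _ _ _ _ _ hA hB hC
  rw [← han, ← hz, ← hs] at h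
  rw [h]
  rw [← hz] at key
  exact key
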